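/- **Notation.** Let $\operatorname{tr}_N=\frac1N\operatorname{Tr}$ on $M_N(\mathbb C)$. For a tuple $\mathbf A_N$ of $N\times N$ matrices, $\tau_{\mathbf A_N}(P)=\operatorname{tr}_N(P(\mathbf A_N))$ denotes its non-commutative distribution, a linear functional on non-commutative polynomials; for two tuples $\mathbf A_N$ ($k$ matrices) and $\mathbf B_N$ ($\ell$ matrices), $\tau_{\mathbf A_N,\mathbf B_N}$ is the joint distribution on $\mathbb C\langle X_1,\dots,X_k,Y_1,\dots,Y_\ell\rangle$, and the free product $\tau_{\mathbf A_N}\star\tau_{\mathbf B_N}$ is the unique linear functional on this algebra that restricts to $\tau_{\mathbf A_N}$ on $\mathbb C\langle X_1,\dots,X_k\rangle$ and to $\tau_{\mathbf B_N}$ on $\mathbb C\langle Y_1,\dots,Y_\ell\rangle$ and for which these two subalgebras are free. A sequence $(\mathbf A_N)_{N\ge1}$ is bounded in n.c. distribution if $\sup_N|\tau_{\mathbf A_N}(P)|<\infty$ for every polynomial $P$. For $\sigma\in S_n$ let $\#\sigma$ be its number of cycles (fixed points included), $|\sigma|=n-\#\sigma$, and let $\mathrm{df}(\alpha,\beta)=|\alpha|+|\alpha^{-1}\beta|-|\beta|\in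 2\mathbb N$ be the defect. For $M_1,\dots,M_n\in M_N(\mathbb C)$ put $$\operatorname{tr}_\sigma(M_1,\dots,M_n)=\prod_{(i_1\dots i_r)\text{ cycle of }\sigma}\operatorname{tr}_N(M_{i_1}\cdots M_{i_r}).$$ Let $G_{2m}$ be the $S_n\times S_n$ matrix with $G_{2m}(\sigma,\alpha)=1$ if $\mathrm{df}(\alpha,\sigma)=2m$ and $0$ otherwise, let $C_0=G_0^{-1}$ and $C_{2g}=-\sum_{i=1}^g C_0G_{2i}C_{2(g-i)}$ for $g\ge1$ (integer matrices). The higher order matricial cumulants are $$\kappa^{(2g)}_\sigma(M_1,\dots,M_n)=\sum_{\alpha\in S_n}C_{2g}(\sigma,\alpha)\operatorname{tr}_\alpha(M_1,\dots,M_n).$$ For a sequence $\mathbf C=(\mathbf C_N)_{N\ge1}$ of tuples put $\|\mathbf C\|_{*,n}=\sup_{N,\ \sigma\in S_n,\ i_1,\dots,i_n}|\operatorname{tr}_\sigma(C_N^{(i_1)},\dots,C_N^{(i_n)})|$, $n\ge1$. **Theorem.** Let $k,\ell\ge0$. For every $N\geq 1$, every $k$-tuple $\mathbf A_N$ and $\ell$-tuple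 $\mathbf B_N$ of $N\times N$ matrices, and every $g\ge1$ there is a linear functional $\tau_{\mathbf A_N}\star_g\tau_{\mathbf B_N}$ on $\mathbb C\langle X_1,\dots,X_k,Y_1,\dots,Y_\ell\rangle$ such that the following holds. 1. For all $n\ge1$, $P_1,\dots,P_n\in\mathbb C\langle X_1,\dots,X_k\rangle$ and $Q_1,\dots,Q_n\in\mathbb C\langle Y_1,\dots,Y_\ell\rangle$, with $A^{(i)}=P_i(\mathbf A_N)$, $B^{(i)}=Q_i(\mathbf B_N)$ and $\gamma_n=(1\,2\dots n)$, the value of $\tau_{\mathbf A_N}\star_g\tau_{\mathbf B_N}$ at $P_1Q_1P_2Q_2\cdots P_nQ_n$ is equal to $$\sum_{\alpha\in S_n:\ \mathrm{df}(\alpha,\gamma_n)\le 2g}\kappa_\alpha^{(2g-\mathrm{df}(\alpha,\gamma_n))}(A^{(1)},\dots,A^{(n)})\,\operatorname{tr}_{\alpha^{-1}\gamma_n}(B^{(1)},\dots,B^{(n)})$$ and also to $$\sum_{\substack{a,b\ge0\text{ even},\ \alpha,\beta\in S_n\\ a+b+\mathrm{df}(\alpha,\alpha\beta)+\mathrm{df}(\alpha\beta,\gamma_n)=2g}}\kappa_\alpha^{(a)}(A^{(1)},\dots,A^{(n)})\,\kappa_\beta^{(b)}(B^{(1)},\dots,B^{(n)}).$$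 2. For every $P\in\mathbb C\langle X_1,\dots,X_k,Y_1,\dots,Y_\ell\rangle$ and every $K\ge0$ there is a constant $C$, depending only on $P$ and $K$, such that for all deterministic sequences $\mathbf A=(\mathbf A_N)_{N\ge1}$ and $\mathbf B=(\mathbf B_N)_{N\ge1}$ of $k$-tuples and $\ell$-tuples of $N\times N$ matrices that are bounded in n.c. distribution, and every sequence $(U_N)_{N\ge1}$ of Haar distributed random unitary matrices, for all $N\ge1$, $$\mathbb E[\tau_{\mathbf A_N,U_N\mathbf B_NU_N^*}(P)]=\tau_{\mathbf A_N}\star\tau_{\mathbf B_N}(P)+\sum_{g=1}^K N^{-2g}\,\tau_{\mathbf A_N}\star_g\tau_{\mathbf B_N}(P)+N^{-2K-2}R_{K+1,N},$$ $$|R_{K+1,N}|\le C\sum_{\substack{a,b\ge1\\ a+b\le\deg P}}\|\mathbf A\|_{*,a}\,\|\mathbf B\|_{*,b}.$$ -/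

import Mathlib

open MeasureTheory

noncomputable section

namespace FreeExpansion

/-! ### Non-commutative distributions -/

/-- The normalized trace `tr_N = N⁻¹ Tr` on `N × N` complex matrices. -/
def normTrace {N : ℕ} : Matrix (Fin N) (Fin N) ℂ →ₗ[ℂ] ℂ :=
  (N : ℂ)⁻¹ • Matrix.traceLinearMap (Fin N) ℂ ℂ

/-- The non-commutative distribution `P ↦ tr_N (P(A))` of a tuple `A` of `N × N` matrices, a linear
functional on the algebra of non-commutative polynomials. -/
def ncDist {ι : Type*} {N : ℕ} (A : ι → Matrix (Fin N) (Fin N) ℂ) : FreeAlgebra ℂ ι →ₗ[ℂ] ℂ :=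
  normTrace ∘ₗ (FreeAlgebra.lift ℂ A).toLinearMap

/-- The inclusion of `ℂ⟨X₁, …, X_k⟩` into `ℂ⟨X₁, …, X_k, Y₁, …, Y_l⟩`. -/
def inX {ι κ : Type*} : FreeAlgebra ℂ ι →ₐ[ℂ] FreeAlgebra ℂ (ι ⊕ κ) :=
  FreeAlgebra.lift ℂ fun i => FreeAlgebra.ι ℂ (Sum.inl i)

/-- The inclusion of `ℂ⟨Y₁, …, Y_l⟩` into `ℂ⟨X₁, …, X_k, Y₁, …, Y_l⟩`. -/
def inY {ι κ : Type*} : FreeAlgebra ℂ κ →ₐ[ℂ] FreeAlgebra ℂ (ι ⊕ κ) :=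
  FreeAlgebra.lift ℂ fun j => FreeAlgebra.ι ℂ (Sum.inr j)

/-- The degree of a non-commutative polynomial: the largest length of a word that occurs in it. -/
def ncDegree {ι : Type*} (P : FreeAlgebra ℂ ι) : ℕ :=
  (FreeAlgebra.equivMonoidAlgebraFreeMonoid P).coeff.support.sup FreeMonoid.length

/-- A sequence of `k`-tuples of `N × N` matrices (`N ≥ 1`) is bounded in non-commutative
distribution. -/
def BoundedInDist {k : ℕ} (A : (N : ℕ+) → Fin k → Matrix (Fin N) (Fin N) ℂ) : Prop :=
  ∀ P : FreeAlgebra ℂ (Fin k), BddAbove (Set.range fun N : ℕ+ => ‖ncDist (A N) P‖)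

/-! ### Freeness and the free product -/

/-- Two unital subalgebras are free with respect to `τ`: alternating products of centred elements
are centred. -/
def AreFree {𝒜 : Type*} [Ring 𝒜] [Algebra ℂ 𝒜] (τ : 𝒜 →ₗ[ℂ] ℂ) (S T : Subalgebra ℂ 𝒜) : Prop :=
  ∀ (n : ℕ) (c : Fin (n + 1) → Bool) (a : Fin (n + 1) → 𝒜),
    (∀ j : Fin n, c j.castSucc ≠ c j.succ) →
    (∀ j, a j ∈ if c j then S else T) →
    (∀ j, τ (a j) = 0) →
    τ (List.ofFn a).prod = 0

/-- `φ` is a free product of the functionals `τ₁` and `τ₂`: it restricts to `τ₁` on the polynomials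
in the `X`'s and to `τ₂` on the polynomials in the `Y`'s, and these two subalgebras are free. -/
def IsFreeProduct {ι κ : Type*} (τ₁ : FreeAlgebra ℂ ι →ₗ[ℂ] ℂ) (τ₂ : FreeAlgebra ℂ κ →ₗ[ℂ] ℂ)
    (φ : FreeAlgebra ℂ (ι ⊕ κ) →ₗ[ℂ] ℂ) : Prop :=
  (∀ P, φ (inX P) = τ₁ P) ∧ (∀ Q, φ (inY Q) = τ₂ Q) ∧
    AreFree φ (inX : FreeAlgebra ℂ ι →ₐ[ℂ] FreeAlgebra ℂ (ι ⊕ κ)).range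
      (inY : FreeAlgebra ℂ κ →ₐ[ℂ] FreeAlgebra ℂ (ι ⊕ κ)).range

/-! ### Permutations: length and defect -/

/-- The number `#σ` of cycles of `σ`, fixed points included. -/
def numCycles {n : ℕ} (σ : Equiv.Perm (Fin n)) : ℕ := Multiset.card σ.partition.parts

/-- The length `|σ| = n - #σ`. -/
def permLength {n : ℕ} (σ : Equiv.Perm (Fin n)) : ℕ := n - numCycles σ

/-- The defect `df(α, β) = |α| + |α⁻¹ β| - |β|`; it is a natural number by the triangle inequality
for `|·|`. -/
def defect {n : ℕ} (α β : Equiv.Perm (Fin n)) : ℕ :=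
  permLength α + permLength (α⁻¹ * β) - permLength β

/-! ### Traces along permutations and higher order matricial cumulants -/

/-- `tr_σ(M₁, …, M_n) = ∏ tr_N(M_{i₁} ⋯ M_{i_r})`, the product over the cycles `(i₁ … i_r)` of `σ`,
fixed points included; each cycle is read from its smallest element `i₁`, and `i_{s+1} = σ(i_s)`. -/
def permTrace {N n : ℕ} (σ : Equiv.Perm (Fin n)) (M : Fin n → Matrix (Fin N) (Fin N) ℂ) : ℂ :=
  ∏ i : Fin n with ∀ j, σ.SameCycle i j → i ≤ j,
    normTrace ((List.range (Function.minimalPeriod σ i)).map fun s => M ((σ ^ s) i)).prod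

/-- The matrix `G_{2m}` with entries `G_{2m}(σ, α) = 1` if `df(α, σ) = 2m`, and `0` otherwise. -/
def defectMatrix (n m : ℕ) : Matrix (Equiv.Perm (Fin n)) (Equiv.Perm (Fin n)) ℤ :=
  Matrix.of fun σ α => if defect α σ = 2 * m then 1 else 0

/-- The integer matrices `C_{2g}`, given by `C₀ = G₀⁻¹` and
`C_{2g} = - ∑_{i=1}^{g} C₀ G_{2i} C_{2(g-i)}` for `g ≥ 1`: the coefficients of the inverse of the
power series `∑_m N^{-2m} G_{2m}` in `N^{-2}`. -/
def cumulantMatrix (n : ℕ) : ℕ → Matrix (Equiv.Perm (Fin n)) (Equiv.Perm (Fin n)) ℤ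
  | 0 => (defectMatrix n 0)⁻¹
  | g + 1 => -∑ i : Fin (g + 1),
      (defectMatrix n 0)⁻¹ * defectMatrix n ((i : ℕ) + 1) * cumulantMatrix n (g - (i : ℕ))

/-- The higher order matricial cumulant
`κ_σ^{(2g)}(M₁, …, M_n) = ∑_α C_{2g}(σ, α) tr_α(M₁, …, M_n)`.
The argument `g` stands for the superscript `2g`. -/
def cumulant {N n : ℕ} (g : ℕ) (σ : Equiv.Perm (Fin n))
    (M : Fin n → Matrix (Fin N) (Fin N) ℂ) : ℂ :=
  ∑ α : Equiv.Perm (Fin n), (cumulantMatrix n g σ α : ℂ) * permTrace α M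

/-- `‖C‖_{*,n}`, the supremum over `N ≥ 1`, `σ ∈ S_n` and indices `i₁, …, i_n` of
`|tr_σ(C_{i₁}, …, C_{i_n})|`. -/
def starNorm {k : ℕ} (C : (N : ℕ+) → Fin k → Matrix (Fin N) (Fin N) ℂ) (n : ℕ) : ℝ :=
  ⨆ x : ℕ+ × Equiv.Perm (Fin n) × (Fin n → Fin k), ‖permTrace x.2.1 fun s => C x.1 (x.2.2 s)‖

/-- The polynomial `P₁(X) Q₁(Y) ⋯ P_n(X) Q_n(Y)`. -/
def alternatingProd {ι κ : Type*} {n : ℕ} (P : Fin n → FreeAlgebra ℂ ι)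
    (Q : Fin n → FreeAlgebra ℂ κ) : FreeAlgebra ℂ (ι ⊕ κ) :=
  (List.ofFn fun s => inX (P s) * inY (Q s)).prod

/-! ### Haar unitary matrices -/

instance (N : ℕ) : MeasurableSpace (Matrix.unitaryGroup (Fin N) ℂ) := borel _

instance (N : ℕ) : BorelSpace (Matrix.unitaryGroup (Fin N) ℂ) := ⟨rfl⟩

/-- A random unitary matrix is Haar distributed: its law is a Haar measure (which is then a
probability measure, under a probability measure `ℙ`). -/
def IsHaarUnitary {Ω : Type*} [MeasurableSpace Ω] (ℙ : Measure Ω) {N : ℕ}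
    (U : Ω → Matrix.unitaryGroup (Fin N) ℂ) : Prop :=
  AEMeasurable U ℙ ∧ (ℙ.map U).IsHaarMeasure

/-- The tuple `(A, U B U*)`, indexed so that `X_i` is sent to `A_i` and `Y_j` to `U B_j U*`. -/
def rotatedTuple {ι κ : Type*} {N : ℕ} (A : ι → Matrix (Fin N) (Fin N) ℂ)
    (B : κ → Matrix (Fin N) (Fin N) ℂ) (U : Matrix.unitaryGroup (Fin N) ℂ) :
    ι ⊕ κ → Matrix (Fin N) (Fin N) ℂ :=
  Sum.elim A fun j => (U : Matrix (Fin N) (Fin N) ℂ) * B j * star (U : Matrix (Fin N) (Fin N) ℂ)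

end FreeExpansion

end

noncomputable section

namespace FreeExpansion

/-! ### Sums over index functions along a permutation -/

/-- The sum `∑_i ∏_s (M_s)_{i(s), i(σ s)}`, the unnormalized trace of a tuple along `σ`. -/
def trSum {ι : Type*} [Fintype ι] [DecidableEq ι] {N : ℕ} (σ : Equiv.Perm ι)
    (M : ι → Matrix (Fin N) (Fin N) ℂ) : ℂ :=
  ∑ i : ι → Fin N, ∏ s, M s (i s) (i (σ s))

theorem trSum_equiv {ι κ : Type*} [Fintype ι] [DecidableEq ι] [Fintype κ] [DecidableEq κ] {N : ℕ}
    (e : κ ≃ ι) (σ : Equiv.Perm ι) (τ : Equiv.Perm κ) (h : ∀ x, σ (e x) = e (τ x))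
    (M : ι → Matrix (Fin N) (Fin N) ℂ) : trSum σ M = trSum τ (fun x => M (e x)) := by
  unfold trSum
  refine Fintype.sum_equiv (Equiv.arrowCongr e.symm (Equiv.refl _)) _ _ fun i => ?_
  refine (Fintype.prod_equiv e _ _ fun x => ?_).symm
  simp [h]

theorem prod_ofFn_apply {N : ℕ} (p : ℕ) (M : Fin (p + 1) → Matrix (Fin N) (Fin N) ℂ)
    (a b : Fin N) :
    (List.ofFn M).prod a b = ∑ i : Fin p → Fin N, ∏ s : Fin (p + 1),
      M s ((Fin.cons a i : Fin (p + 1) → Fin N) s) ((Fin.snoc i b : Fin (p + 1) → Fin N) s) := by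
  induction p generalizing a with
  | zero => simp [Fin.snoc]
  | succ p ih =>
    rw [List.ofFn_succ, List.prod_cons, Matrix.mul_apply]
    rw [← Equiv.sum_comp (Fin.consEquiv fun _ : Fin (p + 1) => Fin N), Fintype.sum_prod_type]
    refine Finset.sum_congr rfl fun c _ => ?_
    rw [ih, Finset.mul_sum]
    refine Finset.sum_congr rfl fun i _ => ?_
    conv_rhs => rw [Fin.prod_univ_succ]
    simp [Fin.consEquiv, ← Fin.cons_snoc_eq_snoc_cons]

theorem trace_prod_ofFn {N : ℕ} {p : ℕ} (hp : 0 < p) (M : Fin p → Matrix (Fin N) (Fin N) ℂ) :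
    (List.ofFn M).prod.trace = trSum (finRotate p) M := by
  obtain ⟨p, rfl⟩ : ∃ q, p = q + 1 := ⟨p - 1, by omega⟩
  unfold trSum
  rw [← Equiv.sum_comp (Fin.consEquiv fun _ : Fin (p + 1) => Fin N), Fintype.sum_prod_type,
    Matrix.trace]
  refine Finset.sum_congr rfl fun a _ => ?_
  rw [Matrix.diag_apply, prod_ofFn_apply]
  refine Finset.sum_congr rfl fun i _ => ?_
  simp [Fin.consEquiv, Fin.snoc_eq_cons_rotate]

theorem trSum_sigma {ρ : Type*} [Fintype ρ] [DecidableEq ρ] {β : ρ → Type*} [∀ r, Fintype (β r)]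
    [∀ r, DecidableEq (β r)] {N : ℕ} (σ : ∀ r, Equiv.Perm (β r))
    (M : (Σ r, β r) → Matrix (Fin N) (Fin N) ℂ) :
    trSum (Equiv.sigmaCongrRight σ) M = ∏ r, trSum (σ r) fun s => M ⟨r, s⟩ := by
  unfold trSum
  rw [Fintype.prod_sum]
  refine Fintype.sum_equiv (Equiv.piCurry fun _ _ => Fin N) _ _ fun i => ?_
  rw [Fintype.prod_sigma]
  rfl

/-! ### Cycles through their least elements -/

/-- The least elements of the cycles of `σ`. -/
abbrev minRep {n : ℕ} (σ : Equiv.Perm (Fin n)) : Type := {i : Fin n // ∀ j, σ.SameCycle i j → i ≤ j}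

instance {n : ℕ} (σ : Equiv.Perm (Fin n)) : Fintype (minRep σ) := Fintype.ofFinite _

theorem minimalPeriod_perm_pos {n : ℕ} (σ : Equiv.Perm (Fin n)) (i : Fin n) :
    0 < Function.minimalPeriod σ i :=
  Function.minimalPeriod_pos_of_mem_periodicPts (σ.injective.mem_periodicPts i)

theorem exists_minRep {n : ℕ} (σ : Equiv.Perm (Fin n)) (i : Fin n) :
    ∃ r : minRep σ, σ.SameCycle r i := by
  classical
  obtain ⟨r, hr, hmin⟩ := (Finset.univ.filter fun j => σ.SameCycle j i).exists_min_image id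
    ⟨i, by simp [Equiv.Perm.SameCycle.refl]⟩
  simp only [Finset.mem_filter, Finset.mem_univ, true_and, id] at hr hmin
  exact ⟨⟨r, fun j hj => hmin j (hj.symm.trans hr)⟩, hr⟩

theorem minRep_unique {n : ℕ} (σ : Equiv.Perm (Fin n)) {r r' : minRep σ}
    (h : σ.SameCycle r r') : r = r' :=
  Subtype.ext (le_antisymm (r.2 _ h) (r'.2 _ h.symm))

/-- The decomposition of `Fin n` into the cycles of `σ`. -/
def cycleEquiv {n : ℕ} (σ : Equiv.Perm (Fin n)) :
    (Σ r : minRep σ, Fin (Function.minimalPeriod σ r)) ≃ Fin n :=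
  Equiv.ofBijective (fun x => (σ ^ (x.2 : ℕ)) x.1) (by
    constructor
    · rintro ⟨r, s⟩ ⟨r', s'⟩ h
      have hr : r = r' := by
        apply minRep_unique
        have h1 : σ.SameCycle r ((σ ^ (s : ℕ)) r) := ⟨s, by simp⟩
        have h2 : σ.SameCycle r' ((σ ^ (s' : ℕ)) r') := ⟨s', by simp⟩
        dsimp only at h
        rw [h] at h1
        exact h1.trans h2.symm
      subst hr
      congr 1
      apply Fin.ext
      refine Function.iterate_injOn_Iio_minimalPeriod (f := σ) (x := r) s.2 s'.2 ?_
      simpa [Equiv.Perm.iterate_eq_pow] using h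
    · intro i
      obtain ⟨r, hr⟩ := exists_minRep σ i
      obtain ⟨m, -, hm⟩ := hr.exists_pow_eq'
      refine ⟨⟨r, ⟨m % Function.minimalPeriod σ r, Nat.mod_lt _ (minimalPeriod_perm_pos σ r)⟩⟩, ?_⟩
      dsimp only
      rw [← Equiv.Perm.iterate_eq_pow, Function.iterate_mod_minimalPeriod_eq,
        Equiv.Perm.iterate_eq_pow, hm])

theorem cycleEquiv_rotate {n : ℕ} (σ : Equiv.Perm (Fin n))
    (x : Σ r : minRep σ, Fin (Function.minimalPeriod σ r)) :
    σ (cycleEquiv σ x) = cycleEquiv σ (Equiv.sigmaCongrRight (fun _ => finRotate _) x) := by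
  obtain ⟨r, s⟩ := x
  change σ ((σ ^ (s : ℕ)) r) = (σ ^ ((finRotate _ s : Fin _) : ℕ)) r
  have hs := s.2
  have : NeZero (Function.minimalPeriod σ r) := ⟨(minimalPeriod_perm_pos σ r).ne'⟩
  rw [finRotate_apply, Fin.val_add, Fin.val_one', Nat.add_mod_mod, ← Equiv.Perm.iterate_eq_pow,
    ← Equiv.Perm.iterate_eq_pow, Function.iterate_mod_minimalPeriod_eq,
    Function.iterate_succ_apply']

theorem card_minRep {n : ℕ} (σ : Equiv.Perm (Fin n)) : Fintype.card (minRep σ) = numCycles σ := by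
  classical
  rw [numCycles, Equiv.Perm.parts_partition, Multiset.card_add, Multiset.card_replicate,
    Equiv.Perm.cycleType_def, Multiset.card_map, Finset.card_val, Fintype.card_subtype,
    ← Finset.card_filter_add_card_filter_not (p := fun i => i ∈ σ.support)]
  congr 1
  · refine Finset.card_bij (fun r _ => σ.cycleOf r) ?_ ?_ ?_
    · intro r hr
      simp only [Finset.mem_filter] at hr
      exact Equiv.Perm.cycleOf_mem_cycleFactorsFinset_iff.2 hr.2
    · intro r hr r' hr' h
      simp only [Finset.mem_filter, Finset.mem_univ, true_and] at hr hr'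
      have := (Equiv.Perm.sameCycle_iff_cycleOf_eq_of_mem_support hr.2 hr'.2).2 h
      exact le_antisymm (hr.1 _ this) (hr'.1 _ this.symm)
    · intro c hc
      obtain ⟨a, ha⟩ : ∃ a, a ∈ c.support :=
        (Equiv.Perm.mem_cycleFactorsFinset_iff.1 hc).1.nonempty_support
      obtain ⟨r, hr⟩ := exists_minRep σ a
      have has : a ∈ σ.support := Equiv.Perm.mem_cycleFactorsFinset_support_le hc ha
      have hrs : (r : Fin n) ∈ σ.support := (hr.mem_support_iff).2 has
      refine ⟨r, by simpa using ⟨r.2, by simpa using hrs⟩, ?_⟩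
      rw [(Equiv.Perm.sameCycle_iff_cycleOf_eq_of_mem_support hrs has).1 hr,
        Equiv.Perm.cycle_is_cycleOf ha hc]
  · rw [← Finset.card_compl]
    congr 1
    ext i
    simp only [Finset.mem_filter, Finset.mem_univ, true_and, Finset.mem_compl,
      and_iff_right_iff_imp]
    intro hi j hj
    have : σ i = i := by simpa using hi
    exact le_of_eq (hj.eq_of_left this)

theorem trace_eq_normTrace {N : ℕ} (hN : N ≠ 0) (M : Matrix (Fin N) (Fin N) ℂ) :
    M.trace = N * normTrace M := by
  have : (N : ℂ) ≠ 0 := by exact_mod_cast hN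
  simp [normTrace, this]

/-- The sum of a tuple along `σ` in terms of normalized traces. -/
theorem trSum_eq {n N : ℕ} (hN : N ≠ 0) (σ : Equiv.Perm (Fin n))
    (M : Fin n → Matrix (Fin N) (Fin N) ℂ) :
    trSum σ M = (N : ℂ) ^ numCycles σ * permTrace σ M := by
  classical
  rw [trSum_equiv (cycleEquiv σ) σ _ (cycleEquiv_rotate σ), trSum_sigma, ← card_minRep,
    ← Finset.card_univ, ← Finset.prod_const, permTrace]
  rw [Finset.prod_subtype (p := fun i => ∀ j, σ.SameCycle i j → i ≤ j) _ (by simp),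
    ← Finset.prod_mul_distrib]
  refine Finset.prod_congr (by ext; simp) fun r _ => ?_
  rw [← trace_eq_normTrace hN, ← trace_prod_ofFn (minimalPeriod_perm_pos σ r)]
  congr 2
  rw [List.ofFn_eq_map, ← List.map_coe_finRange_eq_range, List.map_map]
  rfl

theorem permTrace_one {n N : ℕ} (hN : N ≠ 0) (σ : Equiv.Perm (Fin n)) :
    permTrace σ (fun _ => (1 : Matrix (Fin N) (Fin N) ℂ)) = 1 := by
  have : (N : ℂ) ≠ 0 := by exact_mod_cast hN
  unfold permTrace
  refine Finset.prod_eq_one fun i _ => ?_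
  simp [normTrace, this]

/-! ### The length of a permutation and the defect -/

theorem trSum_one {ι : Type*} [Fintype ι] [DecidableEq ι] {N : ℕ} (σ : Equiv.Perm ι) :
    trSum σ (fun _ => (1 : Matrix (Fin N) (Fin N) ℂ)) =
      (Nat.card {i : ι → Fin N // ∀ s, i (σ s) = i s} : ℂ) := by
  unfold trSum
  rw [Nat.card_eq_fintype_card, Fintype.card_subtype, ← Finset.sum_boole]
  refine Finset.sum_congr rfl fun i _ => ?_
  simp only [Matrix.one_apply]
  rw [Finset.prod_ite_zero]
  simp [eq_comm]

theorem card_invariant {n : ℕ} (N : ℕ) (hN : N ≠ 0) (σ : Equiv.Perm (Fin n)) :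
    Nat.card {i : Fin n → Fin N // ∀ s, i (σ s) = i s} = N ^ numCycles σ := by
  have h := trSum_one (N := N) σ
  rw [trSum_eq hN, permTrace_one hN, mul_one] at h
  exact_mod_cast h.symm

/-- The functions that are constant along the cycles of `σ`. -/
def invariantSubmodule {n : ℕ} (σ : Equiv.Perm (Fin n)) : Submodule (ZMod 2) (Fin n → ZMod 2) where
  carrier := {i | ∀ s, i (σ s) = i s}
  add_mem' ha hb s := by simp [ha s, hb s]
  zero_mem' s := rfl
  smul_mem' c i hi s := by simp [hi s]

theorem finrank_invariantSubmodule {n : ℕ} (σ : Equiv.Perm (Fin n)) :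
    Module.finrank (ZMod 2) (invariantSubmodule σ) = numCycles σ := by
  have := Fintype.ofFinite (invariantSubmodule σ)
  have h1 := Module.card_eq_pow_finrank (K := ZMod 2) (V := invariantSubmodule σ)
  have h2 : Nat.card (invariantSubmodule σ) = 2 ^ numCycles σ := by
    rw [← card_invariant 2 two_ne_zero σ]
    rfl
  rw [← Nat.card_eq_fintype_card, h2, ZMod.card] at h1
  exact (Nat.pow_right_injective le_rfl h1).symm

theorem numCycles_le {n : ℕ} (σ : Equiv.Perm (Fin n)) : numCycles σ ≤ n := by
  rw [← finrank_invariantSubmodule]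
  exact (Submodule.finrank_le _).trans (by simp)

theorem numCycles_add_le {n : ℕ} (α β : Equiv.Perm (Fin n)) :
    numCycles α + numCycles β ≤ n + numCycles (α * β) := by
  simp only [← finrank_invariantSubmodule]
  rw [← Submodule.finrank_sup_add_finrank_inf_eq]
  refine add_le_add ((Submodule.finrank_le _).trans (by simp)) (Submodule.finrank_mono ?_)
  rintro i ⟨h1, h2⟩ s
  rw [Equiv.Perm.mul_apply, h1, h2]

theorem numCycles_eq {n : ℕ} (σ : Equiv.Perm (Fin n)) :
    numCycles σ = Multiset.card σ.cycleType + (n - σ.support.card) := by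
  rw [numCycles, Equiv.Perm.parts_partition, Multiset.card_add, Multiset.card_replicate,
    Fintype.card_fin]

theorem numCycles_inv {n : ℕ} (σ : Equiv.Perm (Fin n)) : numCycles σ⁻¹ = numCycles σ := by
  simp [numCycles_eq]

theorem numCycles_mul_comm {n : ℕ} (α β : Equiv.Perm (Fin n)) :
    numCycles (α * β) = numCycles (β * α) := by
  have : (β * α).cycleType = (α * β).cycleType := by
    rw [← Equiv.Perm.cycleType_conj (σ := α * β) (τ := β)]
    congr 1
    group
  rw [numCycles_eq, numCycles_eq, ← Equiv.Perm.sum_cycleType, ← Equiv.Perm.sum_cycleType, this]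

theorem permLength_add_numCycles {n : ℕ} (σ : Equiv.Perm (Fin n)) :
    permLength σ + numCycles σ = n := Nat.sub_add_cancel (numCycles_le σ)

theorem permLength_inv {n : ℕ} (σ : Equiv.Perm (Fin n)) : permLength σ⁻¹ = permLength σ := by
  rw [permLength, numCycles_inv, permLength]

theorem permLength_mul_le {n : ℕ} (α β : Equiv.Perm (Fin n)) :
    permLength (α * β) ≤ permLength α + permLength β := by
  have := numCycles_add_le α β
  have h1 := permLength_add_numCycles α
  have h2 := permLength_add_numCycles β
  have h3 := permLength_add_numCycles (α * β)
  omega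

theorem sign_eq_permLength {n : ℕ} (σ : Equiv.Perm (Fin n)) :
    Equiv.Perm.sign σ = (-1) ^ permLength σ := by
  have h1 := permLength_add_numCycles σ
  have h2 := σ.support.card_le_univ
  rw [Fintype.card_fin] at h2
  rw [Equiv.Perm.sign_of_cycleType]
  rw [numCycles_eq, ← Equiv.Perm.sum_cycleType] at h1
  rw [← Equiv.Perm.sum_cycleType] at h2
  have : σ.cycleType.sum + Multiset.card σ.cycleType =
    permLength σ + 2 * Multiset.card σ.cycleType := by omega
  rw [this, pow_add, pow_mul]
  simp

theorem permLength_eq_zero {n : ℕ} {σ : Equiv.Perm (Fin n)} : permLength σ = 0 ↔ σ = 1 := by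
  have h1 := permLength_add_numCycles σ
  have h2 := σ.support.card_le_univ
  rw [Fintype.card_fin, ← Equiv.Perm.sum_cycleType] at h2
  rw [numCycles_eq, ← Equiv.Perm.sum_cycleType] at h1
  constructor
  · intro h
    have h3 : 2 * Multiset.card σ.cycleType ≤ σ.cycleType.sum := by
      have := Multiset.card_nsmul_le_sum (s := σ.cycleType) (a := 2)
        fun x hx => Equiv.Perm.two_le_of_mem_cycleType hx
      simpa [mul_comm] using this
    rw [← Equiv.Perm.card_cycleType_eq_zero]
    omega
  · rintro rfl
    simp at h1 ⊢
    omega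

/-- Twice the number of cycles is at most `n` plus the number of fixed points. -/
theorem two_mul_numCycles_le {n : ℕ} (σ : Equiv.Perm (Fin n)) :
    2 * numCycles σ ≤ n + (Finset.univ.filter fun i => σ i = i).card := by
  have h2 := σ.support.card_le_univ
  have h3 : 2 * Multiset.card σ.cycleType ≤ σ.cycleType.sum := by
    have := Multiset.card_nsmul_le_sum (s := σ.cycleType) (a := 2)
      fun x hx => Equiv.Perm.two_le_of_mem_cycleType hx
    simpa [mul_comm] using this
  have h4 : (Finset.univ.filter fun i => σ i = i).card = n - σ.support.card := by
    have h5 : σ.supportᶜ = Finset.univ.filter fun i => σ i = i := by ext; simp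
    rw [← h5, Finset.card_compl, Fintype.card_fin]
  rw [Fintype.card_fin] at h2
  rw [numCycles_eq, h4]
  rw [Equiv.Perm.sum_cycleType] at h3
  omega

theorem numCycles_lt_mul_swap {n : ℕ} {α : Equiv.Perm (Fin n)} {s t : Fin n} (h : α t = s)
    (hst : s ≠ t) : numCycles α < numCycles (α * Equiv.swap s t) := by
  rw [← finrank_invariantSubmodule, ← finrank_invariantSubmodule]
  apply Submodule.finrank_lt_finrank_of_lt
  refine lt_of_le_of_ne (fun i hi x => ?_) fun heq => ?_
  · have h1 : i s = i t := by rw [← h]; exact hi t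
    rw [Equiv.Perm.mul_apply, hi]
    rcases eq_or_ne x s with rfl | hs
    · simp [h1]
    rcases eq_or_ne x t with rfl | ht
    · simp [h1]
    · rw [Equiv.swap_apply_of_ne_of_ne hs ht]
  · have h1 : (Pi.single s 1 : Fin n → ZMod 2) ∈ invariantSubmodule (α * Equiv.swap s t) := by
      intro x
      by_cases hx : x = s
      · subst hx; simp [h]
      · have : (α * Equiv.swap s t) x ≠ s := by
          intro h2
          apply hx
          apply (α * Equiv.swap s t).injective
          rw [h2]; simp [h]
        rw [Pi.single_eq_of_ne this, Pi.single_eq_of_ne hx]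
    rw [← heq] at h1
    have := h1 t
    rw [h] at this
    simp [hst.symm] at this

theorem permLength_mul_swap_lt {n : ℕ} {α : Equiv.Perm (Fin n)} {s t : Fin n} (h : α t = s)
    (hst : s ≠ t) : permLength (α * Equiv.swap s t) < permLength α := by
  have := numCycles_lt_mul_swap h hst
  have h1 := permLength_add_numCycles α
  have h2 := permLength_add_numCycles (α * Equiv.swap s t)
  omega

theorem permLength_le_of_mul {n : ℕ} (α β : Equiv.Perm (Fin n)) :
    permLength β ≤ permLength α + permLength (α⁻¹ * β) := by
  have := permLength_mul_le α (α⁻¹ * β)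
  rwa [mul_inv_cancel_left] at this

theorem defect_add {n : ℕ} (α β : Equiv.Perm (Fin n)) :
    defect α β + permLength β = permLength α + permLength (α⁻¹ * β) :=
  Nat.sub_add_cancel (permLength_le_of_mul α β)

theorem even_defect {n : ℕ} (α β : Equiv.Perm (Fin n)) : Even (defect α β) := by
  have h := defect_add α β
  have h1 : (-1 : ℤˣ) ^ (defect α β) = 1 := by
    have h2 : (-1 : ℤˣ) ^ (defect α β + permLength β) = (-1) ^ permLength β := by
      rw [h, pow_add, ← sign_eq_permLength, ← sign_eq_permLength, ← map_mul, mul_inv_cancel_left,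
        sign_eq_permLength]
    rw [pow_add] at h2
    simpa using h2
  by_contra hodd
  rw [Nat.not_even_iff_odd] at hodd
  rw [hodd.neg_one_pow] at h1
  exact absurd h1 (by decide)

/-- A permutation on a geodesic from the identity to `σ` fixes the fixed points of `σ`. -/
theorem fixed_of_defect_eq_zero {n : ℕ} {α σ : Equiv.Perm (Fin n)} (h : defect α σ = 0)
    {s : Fin n} (hs : σ s = s) : α s = s := by
  by_contra hne
  set ρ := α⁻¹ * σ with hρ
  have hsum := defect_add α σ
  rw [h, zero_add, ← hρ] at hsum
  set t := α⁻¹ s with ht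
  have hα : α t = s := by simp [ht]
  have hst : s ≠ t := fun hst => hne (by rw [← hst] at hα; exact hα)
  have hρs : ρ s = t := by simp [hρ, hs, ht]
  have h1 := permLength_mul_swap_lt hα hst
  have h2 : permLength (Equiv.swap s t * ρ) < permLength ρ := by
    have h3 : ρ⁻¹ t = s := by rw [← hρs]; simp
    have := permLength_mul_swap_lt h3 hst
    rw [permLength_inv] at this
    rw [← permLength_inv, mul_inv_rev, Equiv.swap_inv]
    exact this
  have h4 := permLength_mul_le (α * Equiv.swap s t) (Equiv.swap s t * ρ)
  have h5 : α * Equiv.swap s t * (Equiv.swap s t * ρ) = σ := by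
    rw [mul_assoc, Equiv.swap_mul_self_mul, hρ, mul_inv_cancel_left]
  rw [h5] at h4
  omega

theorem eq_of_defect_eq_zero {n : ℕ} {α σ : Equiv.Perm (Fin n)} (h : defect α σ = 0)
    (hle : permLength σ ≤ permLength α) : α = σ := by
  have h1 := defect_add α σ
  have h2 : permLength (α⁻¹ * σ) = 0 := by omega
  rw [permLength_eq_zero] at h2
  exact (inv_mul_eq_one.1 h2)

theorem defect_self {n : ℕ} (α : Equiv.Perm (Fin n)) : defect α α = 0 := by
  have h1 := defect_add α α
  have : permLength (α⁻¹ * α) = 0 := by rw [permLength_eq_zero]; simp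
  omega

theorem numCycles_finRotate {n : ℕ} (hn : 1 ≤ n) : numCycles (finRotate n) = 1 := by
  obtain ⟨n, rfl⟩ : ∃ m, n = m + 1 := ⟨n - 1, by omega⟩
  rcases n with _ | n
  · have := permLength_add_numCycles (finRotate (0 + 1))
    have hsub : Subsingleton (Fin (0 + 1)) := inferInstanceAs (Subsingleton (Fin 1))
    rw [permLength_eq_zero.2 (Subsingleton.elim _ _)] at this
    omega
  · rw [numCycles_eq, cycleType_finRotate, support_finRotate]
    simp

theorem defect_add_defect {n : ℕ} (α β γ : Equiv.Perm (Fin n)) :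
    defect α γ + defect β (α⁻¹ * γ) = defect α (α * β) + defect (α * β) γ := by
  have h1 := defect_add α γ
  have h2 := defect_add β (α⁻¹ * γ)
  have h3 := defect_add α (α * β)
  have h4 := defect_add (α * β) γ
  rw [inv_mul_cancel_left] at h3
  rw [mul_inv_rev, mul_assoc] at h4
  omega

/-- A geodesic from the identity to the long cycle and its complement have together at least two
fixed points. -/
theorem two_le_card_fixed {n : ℕ} (hn : 1 ≤ n) {α : Equiv.Perm (Fin n)}
    (h : defect α (finRotate n) = 0) :
    2 ≤ (Finset.univ.filter fun i => α i = i).card +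
      (Finset.univ.filter fun i => (α⁻¹ * finRotate n) i = i).card := by
  have h1 := defect_add α (finRotate n)
  have h2 := permLength_add_numCycles α
  have h3 := permLength_add_numCycles (α⁻¹ * finRotate n)
  have h4 := permLength_add_numCycles (finRotate n)
  have h5 := numCycles_finRotate hn
  have h6 := two_mul_numCycles_le α
  have h7 := two_mul_numCycles_le (α⁻¹ * finRotate n)
  omega

/-! ### The matrices of the cumulants -/

theorem defectMatrix_apply (n m : ℕ) (σ α : Equiv.Perm (Fin n)) :
    defectMatrix n m σ α = if defect α σ = 2 * m then 1 else 0 := rfl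

theorem det_defectMatrix_zero (n : ℕ) : (defectMatrix n 0).det = 1 := by
  have hb : (defectMatrix n 0).BlockTriangular numCycles := by
    intro σ α h
    rw [defectMatrix_apply, if_neg]
    intro h0
    have h1 := permLength_add_numCycles α
    have h2 := permLength_add_numCycles σ
    have := eq_of_defect_eq_zero (by simpa using h0) (by omega : permLength σ ≤ permLength α)
    subst this
    exact lt_irrefl _ h
  rw [hb.det]
  refine Finset.prod_eq_one fun k _ => ?_
  have : (defectMatrix n 0).toSquareBlock numCycles k = 1 := by
    ext σ α
    rw [Matrix.toSquareBlock_def, Matrix.of_apply, defectMatrix_apply, Matrix.one_apply]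
    by_cases h : σ = α
    · subst h; simp [defect_self]
    · rw [if_neg, if_neg h]
      intro h0
      have h1 := permLength_add_numCycles (α : Equiv.Perm (Fin n))
      have h2 := permLength_add_numCycles (σ : Equiv.Perm (Fin n))
      have h3 := α.2
      have h4 := σ.2
      exact h (Subtype.ext (eq_of_defect_eq_zero (by simpa using h0) (by omega)).symm)
  rw [this, Matrix.det_one]

theorem defectMatrix_mul_inv (n : ℕ) : defectMatrix n 0 * (defectMatrix n 0)⁻¹ = 1 :=
  Matrix.mul_nonsing_inv _ (by rw [det_defectMatrix_zero]; exact isUnit_one)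

theorem cumulantMatrix_succ (n g : ℕ) : cumulantMatrix n (g + 1) = -∑ i : Fin (g + 1),
    (defectMatrix n 0)⁻¹ * defectMatrix n ((i : ℕ) + 1) * cumulantMatrix n (g - (i : ℕ)) := by
  rw [cumulantMatrix]

theorem cumulantMatrix_zero (n : ℕ) : cumulantMatrix n 0 = (defectMatrix n 0)⁻¹ := by
  rw [cumulantMatrix]

theorem sum_defectMatrix_mul_cumulantMatrix (n g : ℕ) :
    ∑ p ∈ Finset.HasAntidiagonal.antidiagonal g, defectMatrix n p.1 * cumulantMatrix n p.2 =
      if g = 0 then 1 else 0 := by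
  cases g with
  | zero => simp [cumulantMatrix_zero, defectMatrix_mul_inv]
  | succ g =>
    rw [Finset.Nat.antidiagonal_succ, Finset.sum_cons, Finset.sum_map, cumulantMatrix_succ,
      Matrix.mul_neg, Matrix.mul_sum, Finset.Nat.sum_antidiagonal_eq_sum_range_succ_mk,
      Finset.sum_range, if_neg (Nat.succ_ne_zero g), neg_add_eq_zero]
    refine Finset.sum_congr rfl fun i _ => ?_
    rw [← Matrix.mul_assoc, ← Matrix.mul_assoc, defectMatrix_mul_inv, Matrix.one_mul]
    rfl

theorem sum_cumulantMatrix_mul_defectMatrix (n g : ℕ) :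
    ∑ p ∈ Finset.HasAntidiagonal.antidiagonal g, cumulantMatrix n p.1 * defectMatrix n p.2 =
      if g = 0 then 1 else 0 := by
  classical
  let S := Equiv.Perm (Fin n)
  let toSeries : (ℕ → Matrix S S ℤ) → Matrix S S (PowerSeries ℤ) :=
    fun f => Matrix.of fun σ α => PowerSeries.mk fun m => f m σ α
  have hcoeff : ∀ (f h : ℕ → Matrix S S ℤ) (σ α : S) (g : ℕ),
      PowerSeries.coeff g ((toSeries f * toSeries h) σ α) =
        (∑ p ∈ Finset.HasAntidiagonal.antidiagonal g, f p.1 * h p.2) σ α := by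
    intro f h σ α g
    rw [Matrix.mul_apply, map_sum, Matrix.sum_apply]
    simp only [PowerSeries.coeff_mul, toSeries, Matrix.of_apply, PowerSeries.coeff_mk,
      Matrix.mul_apply]
    rw [Finset.sum_comm]
  have h1 : toSeries (defectMatrix n) * toSeries (cumulantMatrix n) = 1 := by
    ext σ α g
    rw [hcoeff, sum_defectMatrix_mul_cumulantMatrix]
    by_cases hg : g = 0 <;> by_cases h : σ = α <;>
      simp [hg, h, Matrix.one_apply, PowerSeries.coeff_one]
  have h2 := mul_eq_one_comm.1 h1
  ext σ α
  rw [← hcoeff, h2]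
  by_cases hg : g = 0 <;> by_cases h : σ = α <;>
    simp [hg, h, Matrix.one_apply, PowerSeries.coeff_one]

/-- The coefficients of the expansion of a trace in cumulants. -/
theorem sum_cumulant {N n : ℕ} (h : ℕ) (σ : Equiv.Perm (Fin n))
    (M : Fin n → Matrix (Fin N) (Fin N) ℂ) :
    ∑ b ∈ Finset.range (h + 1), ∑ β : Equiv.Perm (Fin n) with 2 * b + defect β σ = 2 * h,
      cumulant b β M = if h = 0 then permTrace σ M else 0 := by
  have key := congrArg (fun m : Matrix (Equiv.Perm (Fin n)) (Equiv.Perm (Fin n)) ℤ =>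
    ∑ α, (m σ α : ℂ) * permTrace α M) (sum_defectMatrix_mul_cumulantMatrix n h)
  have hr : (∑ α, (((if h = 0 then (1 : Matrix (Equiv.Perm (Fin n)) (Equiv.Perm (Fin n)) ℤ)
      else 0) σ α : ℤ) : ℂ) * permTrace α M) = if h = 0 then permTrace σ M else 0 := by
    split_ifs with hh <;> simp [Matrix.one_apply]
  rw [← hr, ← key, ← Finset.Nat.sum_antidiagonal_swap,
    Finset.Nat.sum_antidiagonal_eq_sum_range_succ_mk]
  simp only [Matrix.sum_apply, Matrix.mul_apply, Int.cast_sum, Finset.sum_mul, Prod.swap]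
  rw [Finset.sum_comm]
  refine Finset.sum_congr rfl fun b hb => ?_
  rw [Finset.sum_comm, Finset.sum_filter]
  refine Finset.sum_congr rfl fun β _ => ?_
  have hb' : b ≤ h := by simpa [Nat.lt_succ_iff] using hb
  rw [defectMatrix_apply]
  by_cases hd : defect β σ = 2 * (h - b)
  · rw [if_pos (by omega), cumulant]
    exact Finset.sum_congr rfl fun α _ => by rw [if_pos hd]; simp
  · rw [if_neg (by omega)]
    exact (Finset.sum_eq_zero fun α _ => by rw [if_neg hd]; simp).symm

/-- The coefficient of `N^{-2g}` in the expansion of the mixed moment. -/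
def mixedCoeff {N n : ℕ} (g : ℕ) (A B : Fin n → Matrix (Fin N) (Fin N) ℂ) : ℂ :=
  ∑ α : Equiv.Perm (Fin n) with defect α (finRotate n) ≤ 2 * g,
    cumulant (g - defect α (finRotate n) / 2) α A * permTrace (α⁻¹ * finRotate n) B

theorem mixedCoeff_eq_sum_range {N n : ℕ} (g : ℕ) (A B : Fin n → Matrix (Fin N) (Fin N) ℂ) :
    mixedCoeff g A B = ∑ α : Equiv.Perm (Fin n),
      ∑ a ∈ Finset.range (g + 1) with 2 * a + defect α (finRotate n) = 2 * g,
        cumulant a α A * permTrace (α⁻¹ * finRotate n) B := by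
  rw [mixedCoeff, Finset.sum_filter]
  refine Finset.sum_congr rfl fun α _ => ?_
  obtain ⟨d, hd⟩ := (even_defect α (finRotate n)).two_dvd
  split_ifs with h
  · rw [Finset.sum_eq_single_of_mem (g - d)]
    · rw [hd, Nat.mul_div_cancel_left _ two_pos]
    · simp only [Finset.mem_filter, Finset.mem_range]; omega
    · intro a ha hne
      simp only [Finset.mem_filter, Finset.mem_range] at ha; omega
  · refine (Finset.sum_eq_zero fun a ha => ?_).symm
    simp only [Finset.mem_filter, Finset.mem_range] at ha; omega

theorem mixedCoeff_eq_sum_cumulant_mul_cumulant {N n : ℕ} (g : ℕ)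
    (A B : Fin n → Matrix (Fin N) (Fin N) ℂ) :
    mixedCoeff g A B = ∑ a ∈ Finset.range (g + 1), ∑ b ∈ Finset.range (g + 1),
      ∑ α : Equiv.Perm (Fin n), ∑ β : Equiv.Perm (Fin n) with
        2 * a + 2 * b + defect α (α * β) + defect (α * β) (finRotate n) = 2 * g,
        cumulant a α A * cumulant b β B := by
  rw [mixedCoeff_eq_sum_range]
  have hswap : ∀ a ∈ Finset.range (g + 1), (∑ b ∈ Finset.range (g + 1),
      ∑ α : Equiv.Perm (Fin n), ∑ β : Equiv.Perm (Fin n) with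
        2 * a + 2 * b + defect α (α * β) + defect (α * β) (finRotate n) = 2 * g,
        cumulant a α A * cumulant b β B) = ∑ α : Equiv.Perm (Fin n),
      ∑ b ∈ Finset.range (g + 1), ∑ β : Equiv.Perm (Fin n) with
        2 * a + 2 * b + defect α (α * β) + defect (α * β) (finRotate n) = 2 * g,
        cumulant a α A * cumulant b β B := fun a _ => Finset.sum_comm
  rw [Finset.sum_congr rfl hswap, Finset.sum_comm]
  refine Finset.sum_congr rfl fun α _ => ?_
  rw [Finset.sum_filter]
  refine Finset.sum_congr rfl fun a ha => ?_
  obtain ⟨d, hd⟩ := (even_defect α (finRotate n)).two_dvd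
  have ha' : a ≤ g := by simpa [Nat.lt_succ_iff] using ha
  have hdd : ∀ β, defect α (α * β) + defect (α * β) (finRotate n) =
      2 * d + defect β (α⁻¹ * finRotate n) := fun β => by rw [← hd, defect_add_defect]
  by_cases hle : a + d ≤ g
  · have hk := sum_cumulant (g - (a + d)) (α⁻¹ * finRotate n) B
    have hsub : Finset.range (g - (a + d) + 1) ⊆ Finset.range (g + 1) := by
      intro x; simp only [Finset.mem_range]; omega
    rw [← Finset.sum_subset hsub]
    · have : ∀ b ∈ Finset.range (g - (a + d) + 1), (∑ β : Equiv.Perm (Fin n) with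
          2 * a + 2 * b + defect α (α * β) + defect (α * β) (finRotate n) = 2 * g,
          cumulant a α A * cumulant b β B) = cumulant a α A * ∑ β : Equiv.Perm (Fin n) with
            2 * b + defect β (α⁻¹ * finRotate n) = 2 * (g - (a + d)), cumulant b β B := by
        intro b _
        rw [Finset.mul_sum]
        refine Finset.sum_congr (Finset.filter_congr fun β _ => ?_) fun _ _ => rfl
        have := hdd β
        omega
      rw [Finset.sum_congr rfl this, ← Finset.mul_sum, hk, mul_ite, mul_zero]
      refine if_congr ?_ rfl rfl
      omega
    · intro b _ hb
      refine Finset.sum_eq_zero fun β hβ => ?_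
      simp only [Finset.mem_filter, Finset.mem_range] at hβ hb
      have := hdd β
      omega
  · rw [if_neg (by omega)]
    refine (Finset.sum_eq_zero fun b _ => Finset.sum_eq_zero fun β hβ => ?_).symm
    simp only [Finset.mem_filter] at hβ
    have := hdd β
    omega

section

/-! ### Tensor products of matrices and the commutant of the tensor powers of unitary matrices -/

variable {ι : Type*} [Fintype ι] {N : ℕ}

/-- The tensor product of a family of matrices. -/
def tensorMat (X : ι → Matrix (Fin N) (Fin N) ℂ) : Matrix (ι → Fin N) (ι → Fin N) ℂ :=
  Matrix.of fun i j => ∏ s, X s (i s) (j s)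

theorem tensorMat_apply (X : ι → Matrix (Fin N) (Fin N) ℂ) (i j : ι → Fin N) :
    tensorMat X i j = ∏ s, X s (i s) (j s) := rfl

/-- The permutation of the tensor factors. -/
def permMat (N : ℕ) (σ : Equiv.Perm ι) : Matrix (ι → Fin N) (ι → Fin N) ℂ :=
  Matrix.of fun i k => if k = i ∘ σ then 1 else 0

theorem permMat_apply (σ : Equiv.Perm ι) (i k : ι → Fin N) :
    permMat N σ i k = if k = i ∘ σ then 1 else 0 := rfl

theorem tensorMat_one : tensorMat (fun _ : ι => (1 : Matrix (Fin N) (Fin N) ℂ)) = 1 := by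
  ext i j
  simp only [tensorMat_apply, Matrix.one_apply, Finset.prod_ite_zero]
  simp [funext_iff]

theorem tensorMat_single (i k : ι → Fin N) :
    tensorMat (fun s => Matrix.single (i s) (k s) (1 : ℂ)) = Matrix.single i k 1 := by
  ext a b
  simp only [tensorMat_apply, Matrix.single_apply, Finset.prod_ite_zero]
  simp [funext_iff, forall_and]

theorem permMat_one : permMat N (1 : Equiv.Perm ι) = 1 := by
  ext i k
  simp [permMat_apply, Matrix.one_apply, eq_comm]

variable [DecidableEq ι]

theorem tensorMat_mul (X Y : ι → Matrix (Fin N) (Fin N) ℂ) :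
    tensorMat X * tensorMat Y = tensorMat fun s => X s * Y s := by
  ext i j
  simp only [Matrix.mul_apply, tensorMat_apply, Fintype.prod_sum, Finset.prod_mul_distrib]

theorem permMat_mul_apply (σ : Equiv.Perm ι) (S : Matrix (ι → Fin N) (ι → Fin N) ℂ)
    (i k : ι → Fin N) : (permMat N σ * S) i k = S (i ∘ σ) k := by
  simp [Matrix.mul_apply, permMat_apply]

theorem mul_permMat_apply (σ : Equiv.Perm ι) (S : Matrix (ι → Fin N) (ι → Fin N) ℂ)
    (i k : ι → Fin N) : (S * permMat N σ) i k = S i (k ∘ σ.symm) := by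
  have : ∀ j : ι → Fin N, k = j ∘ σ ↔ j = k ∘ σ.symm := fun j => by
    rw [Equiv.eq_comp_symm, eq_comm]
  simp [Matrix.mul_apply, permMat_apply, this]

theorem permMat_mul (σ τ : Equiv.Perm ι) : permMat N σ * permMat N τ = permMat N (σ * τ) := by
  ext i k
  rw [permMat_mul_apply]
  rfl

theorem permMat_conj_tensorMat (σ : Equiv.Perm ι) (X : ι → Matrix (Fin N) (Fin N) ℂ) :
    permMat N σ * tensorMat X * permMat N σ⁻¹ = tensorMat (X ∘ σ.symm) := by
  ext i k
  rw [mul_permMat_apply, permMat_mul_apply, tensorMat_apply, tensorMat_apply]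
  refine Fintype.prod_equiv σ _ _ fun s => ?_
  simp [Equiv.Perm.inv_def]

variable {T : Matrix (ι → Fin N) (ι → Fin N) ℂ}

theorem commute_tensorMat_diagonal
    (hT : ∀ U : Matrix.unitaryGroup (Fin N) ℂ, Commute T (tensorMat fun _ => (U : Matrix _ _ ℂ)))
    (z : Fin N → ℂ) : Commute T (tensorMat fun _ => Matrix.diagonal z) := by
  have hd : ∀ z : Fin N → ℂ, tensorMat (fun _ : ι => Matrix.diagonal z) =
      Matrix.diagonal fun i : ι → Fin N => ∏ s, z (i s) := by
    intro z
    ext i j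
    simp only [tensorMat_apply, Matrix.diagonal_apply, Finset.prod_ite_zero]
    simp [funext_iff]
  have hcomm : ∀ z : Fin N → ℂ, Commute T (tensorMat fun _ => Matrix.diagonal z) ↔
      ∀ i j, T i j * ∏ s, z (j s) = (∏ s, z (i s)) * T i j := by
    intro z
    rw [hd, Commute, SemiconjBy, ← Matrix.ext_iff]
    simp only [Matrix.mul_diagonal, Matrix.diagonal_mul]
  rw [hcomm]
  intro i j
  let p : MvPolynomial (Fin N) ℂ :=
    MvPolynomial.C (T i j) * ∏ s, MvPolynomial.X (j s)
  let q : MvPolynomial (Fin N) ℂ :=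
    (∏ s, MvPolynomial.X (i s)) * MvPolynomial.C (T i j)
  have hpq : p = q := by
    refine MvPolynomial.funext_set (fun _ => (Metric.sphere (0 : ℂ) 1)) (fun _ => ?_) ?_
    · exact (isPreconnected_sphere (by simp [Complex.rank_real_complex])
      (0 : ℂ) 1).infinite_of_nontrivial
        ⟨1, by simp, -1, by simp, by norm_num⟩
    · intro x hx
      have hx1 : ∀ i, ‖x i‖ = 1 := fun i => by simpa using hx i trivial
      have hu : Matrix.diagonal x ∈ Matrix.unitaryGroup (Fin N) ℂ := by
        rw [Matrix.mem_unitaryGroup_iff, Matrix.star_eq_conjTranspose,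
          Matrix.diagonal_conjTranspose, Matrix.diagonal_mul_diagonal, ← Matrix.diagonal_one]
        congr 1
        ext i
        rw [Pi.star_apply, Complex.star_def, Complex.mul_conj, Complex.normSq_eq_norm_sq, hx1]
        simp
      have := (hcomm x).1 (hT ⟨_, hu⟩) i j
      simpa [p, q, map_prod] using this
  have := congrArg (MvPolynomial.eval z) hpq
  simpa [p, q, map_prod] using this

theorem commute_tensorMat_hermitian
    (hT : ∀ U : Matrix.unitaryGroup (Fin N) ℂ, Commute T (tensorMat fun _ => (U : Matrix _ _ ℂ)))
    {H : Matrix (Fin N) (Fin N) ℂ} (hH : H.IsHermitian) : Commute T (tensorMat fun _ => H) := by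
  have h := hH.spectral_theorem
  rw [Unitary.conjStarAlgAut_apply] at h
  rw [h, ← tensorMat_mul, ← tensorMat_mul]
  exact ((hT _).mul_right (commute_tensorMat_diagonal hT _)).mul_right
    (hT (star hH.eigenvectorUnitary))

theorem commute_tensorMat_const
    (hT : ∀ U : Matrix.unitaryGroup (Fin N) ℂ, Commute T (tensorMat fun _ => (U : Matrix _ _ ℂ)))
    (X : Matrix (Fin N) (Fin N) ℂ) : Commute T (tensorMat fun _ => X) := by
  obtain ⟨H, K, hH, hK, rfl⟩ : ∃ H K : Matrix (Fin N) (Fin N) ℂ, H.IsHermitian ∧ K.IsHermitian ∧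
      X = H + Complex.I • K := by
    refine ⟨realPart X, imaginaryPart X, (realPart X).2, (imaginaryPart X).2, ?_⟩
    exact (realPart_add_I_smul_imaginaryPart X).symm
  have hcomm : ∀ z : ℂ, Commute T (tensorMat fun _ => H + z • K) ↔
      ∀ i j, ∑ k, T i k * ∏ s, (H (k s) (j s) + K (k s) (j s) * z) =
        ∑ k, (∏ s, (H (i s) (k s) + K (i s) (k s) * z)) * T k j := by
    intro z
    rw [Commute, SemiconjBy, ← Matrix.ext_iff]
    simp [Matrix.mul_apply, tensorMat_apply, mul_comm z]
  rw [hcomm]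
  intro i j
  let p : Polynomial ℂ := ∑ k, Polynomial.C (T i k) *
    ∏ s, (Polynomial.C (H (k s) (j s)) + Polynomial.X * Polynomial.C (K (k s) (j s)))
  let q : Polynomial ℂ := ∑ k, (∏ s, (Polynomial.C (H (i s) (k s)) +
    Polynomial.X * Polynomial.C (K (i s) (k s)))) * Polynomial.C (T k j)
  have hpq : p = q := by
    apply Polynomial.eq_of_infinite_eval_eq
    refine (Set.infinite_range_of_injective Complex.ofReal_injective).mono ?_
    rintro _ ⟨t, rfl⟩
    have hher : (H + (t : ℂ) • K).IsHermitian := by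
      refine hH.add ?_
      rw [Matrix.IsHermitian, Matrix.conjTranspose_smul, hK.eq]
      simp
    have := (hcomm t).1 (commute_tensorMat_hermitian hT hher) i j
    simpa [p, q, Polynomial.eval_finsetSum, Polynomial.eval_prod] using this
  have := congrArg (Polynomial.eval Complex.I) hpq
  simpa [p, q, Polynomial.eval_finsetSum, Polynomial.eval_prod] using this

/-- Polarization: the symmetrized tensor product as a combination of tensor powers. -/
theorem sum_tensorMat_comp (X : ι → Matrix (Fin N) (Fin N) ℂ) :
    ∑ σ : Equiv.Perm ι, tensorMat (X ∘ σ) =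
      ∑ t : Finset ι, (-1 : ℤ) ^ t.card • tensorMat fun _ => ∑ s ∈ tᶜ, X s := by
  have h := Finset.inclusion_exclusion_sum_inf_compl (Finset.univ : Finset ι)
    (fun x : ι => (Finset.univ : Finset (ι → ι)).filter fun f => ∀ s, f s ≠ x)
    (fun f => tensorMat (X ∘ f))
  rw [Finset.powerset_univ] at h
  have hl : ∑ σ : Equiv.Perm ι, tensorMat (X ∘ σ) = ∑ f ∈ (Finset.univ : Finset ι).inf
      (fun x => ((Finset.univ : Finset (ι → ι)).filter fun f => ∀ s, f s ≠ x)ᶜ),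
        tensorMat (X ∘ f) := by
    refine Finset.sum_bij (fun σ _ => (σ : ι → ι)) ?_ ?_ ?_ (fun _ _ => rfl)
    · intro σ _
      simp only [Finset.mem_inf, Finset.mem_compl, Finset.mem_filter, Finset.mem_univ, true_and,
        forall_const]
      intro x hx
      exact hx (σ.symm x) (by simp)
    · intro σ _ τ _ hστ
      exact Equiv.coe_fn_injective hστ
    · intro f hf
      simp only [Finset.mem_inf, Finset.mem_compl, Finset.mem_filter, Finset.mem_univ, true_and,
        forall_const, not_forall, not_not] at hf
      exact ⟨Equiv.ofBijective f (Finite.surjective_iff_bijective.1 hf), Finset.mem_univ _, rfl⟩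
  rw [hl, h]
  refine Finset.sum_congr rfl fun t _ => ?_
  congr 1
  ext i j
  rw [Matrix.sum_apply, tensorMat_apply]
  simp only [Matrix.sum_apply, tensorMat_apply, Function.comp_apply]
  rw [Finset.prod_univ_sum]
  refine Finset.sum_congr ?_ fun _ _ => rfl
  ext f
  simp only [Finset.mem_inf, Finset.mem_filter, Finset.mem_univ, true_and, Fintype.mem_piFinset,
    Finset.mem_compl]
  exact ⟨fun h s hs => h _ hs s rfl, fun h x hx s hs => h s (hs ▸ hx)⟩

theorem commute_sum_permMat_conj
    (hT : ∀ U : Matrix.unitaryGroup (Fin N) ℂ, Commute T (tensorMat fun _ => (U : Matrix _ _ ℂ)))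
    (S : Matrix (ι → Fin N) (ι → Fin N) ℂ) :
    Commute T (∑ σ : Equiv.Perm ι, permMat N σ * S * permMat N σ⁻¹) := by
  have hX : ∀ X : ι → Matrix (Fin N) (Fin N) ℂ,
      Commute T (∑ σ : Equiv.Perm ι, permMat N σ * tensorMat X * permMat N σ⁻¹) := by
    intro X
    have : ∑ σ : Equiv.Perm ι, permMat N σ * tensorMat X * permMat N σ⁻¹ =
        ∑ σ : Equiv.Perm ι, tensorMat (X ∘ σ) := by
      rw [← Equiv.sum_comp (Equiv.inv (Equiv.Perm ι)) fun σ => tensorMat (X ∘ σ)]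
      exact Finset.sum_congr rfl fun σ _ => permMat_conj_tensorMat σ X
    rw [this, sum_tensorMat_comp]
    exact Commute.sum_right _ _ _ fun t _ => (commute_tensorMat_const hT _).smul_right _
  induction S using Matrix.induction_on' with
  | h_zero => simp
  | h_add S S' h h' =>
    simp only [mul_add, add_mul, Finset.sum_add_distrib]
    exact h.add_right h'
  | h_std_basis i k c =>
    have := (hX fun s => Matrix.single (i s) (k s) 1).smul_right c
    rw [tensorMat_single, Finset.smul_sum] at this
    convert this using 2
    ext σ : 1
    rw [← Matrix.smul_mul, ← Matrix.mul_smul, Matrix.smul_single, smul_eq_mul, mul_one]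

theorem sum_single_column (Q : Matrix (ι → Fin N) (ι → Fin N) ℂ →ₗ[ℂ]
      Matrix (ι → Fin N) (ι → Fin N) ℂ) (X : Matrix (ι → Fin N) (ι → Fin N) ℂ)
    (i j : ι → Fin N) :
    Q X i j = ∑ l, ((Matrix.of fun i k => Q (Matrix.single k l 1) i j) * X :
      Matrix (ι → Fin N) (ι → Fin N) ℂ) i l := by
  conv_lhs => rw [Matrix.matrix_eq_sum_single X]
  simp only [map_sum, Matrix.sum_apply, Matrix.mul_apply, Matrix.of_apply]
  rw [Finset.sum_comm]
  refine Finset.sum_congr rfl fun l _ => Finset.sum_congr rfl fun k _ => ?_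
  have : Matrix.single k l (X k l) = X k l • Matrix.single k l (1 : ℂ) := by
    rw [Matrix.smul_single, smul_eq_mul, mul_one]
  rw [this, map_smul, Matrix.smul_apply, smul_eq_mul, mul_comm]

/-- The commutant of the tensor powers of unitary matrices is spanned by the permutations of the
tensor factors. -/
theorem exists_eq_sum_permMat
    (hT : ∀ U : Matrix.unitaryGroup (Fin N) ℂ, Commute T (tensorMat fun _ => (U : Matrix _ _ ℂ))) :
    ∃ c : Equiv.Perm ι → ℂ, T = ∑ α, c α • permMat N α := by
  let V := Submodule.span ℂ (Set.range (permMat N : Equiv.Perm ι → _))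
  have hmem : ∀ σ : Equiv.Perm ι, permMat N σ ∈ V := fun σ => Submodule.subset_span ⟨σ, rfl⟩
  have hmul : ∀ σ : Equiv.Perm ι, ∀ X ∈ V, permMat N σ * X ∈ V := by
    intro σ X hX
    induction hX using Submodule.span_induction with
    | mem x hx => obtain ⟨τ, rfl⟩ := hx; rw [permMat_mul]; exact hmem _
    | zero => simp
    | add x y _ _ hx hy => rw [mul_add]; exact V.add_mem hx hy
    | smul c x _ hx => rw [Matrix.mul_smul]; exact V.smul_mem c hx
  obtain ⟨Q0, hQ0⟩ := V.subtype.exists_leftInverse_of_injective (by simp)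
  let Q1 := V.subtype ∘ₗ Q0
  have hQ1 : ∀ X ∈ V, Q1 X = X := fun X hX =>
    congrArg Subtype.val (LinearMap.congr_fun hQ0 ⟨X, hX⟩)
  let Q : Matrix (ι → Fin N) (ι → Fin N) ℂ → Matrix (ι → Fin N) (ι → Fin N) ℂ :=
    fun X => ∑ σ : Equiv.Perm ι, permMat N σ * Q1 (permMat N σ⁻¹ * X)
  have hQV : ∀ X, Q X ∈ V := fun X => V.sum_mem fun σ _ => hmul _ _ (Q0 _).2
  have hQ_one : Q 1 = (Fintype.card (Equiv.Perm ι) : ℂ) • 1 := by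
    have : ∀ σ : Equiv.Perm ι, permMat N σ * Q1 (permMat N σ⁻¹ * 1) = 1 := fun σ => by
      rw [mul_one, hQ1 _ (hmem _), permMat_mul, mul_inv_cancel, permMat_one]
    simp only [Q, this, Finset.sum_const, Finset.card_univ]
    rw [Nat.cast_smul_eq_nsmul]
  have hQ_entry : ∀ X i j, Q X i j = ∑ l, ((∑ σ : Equiv.Perm ι, permMat N σ *
      (Matrix.of fun i k => Q1 (Matrix.single k l 1) i j) * permMat N σ⁻¹) * X) i l := by
    intro X i j
    simp only [Q, Matrix.sum_apply, Finset.sum_mul]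
    rw [Finset.sum_comm]
    refine Finset.sum_congr rfl fun σ _ => ?_
    rw [permMat_mul_apply, sum_single_column]
    refine Finset.sum_congr rfl fun l _ => ?_
    rw [mul_assoc, mul_assoc, permMat_mul_apply]
  have hQT : Q T = T * Q 1 := by
    ext i j
    rw [hQ_entry, Matrix.mul_apply]
    simp only [hQ_entry, Finset.mul_sum, mul_one]
    rw [Finset.sum_comm]
    refine Finset.sum_congr rfl fun l _ => ?_
    rw [← (commute_sum_permMat_conj hT _).eq, Matrix.mul_apply]
  have hTV : T ∈ V := by
    have h1 := hQV T
    rw [hQT, hQ_one, Matrix.mul_smul, mul_one] at h1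
    have hc : (Fintype.card (Equiv.Perm ι) : ℂ) ≠ 0 := by exact_mod_cast Fintype.card_ne_zero
    exact (Submodule.smul_mem_iff _ hc).1 h1
  obtain ⟨c, hc⟩ := (Submodule.mem_span_range_iff_exists_fun ℂ).1 hTV
  exact ⟨c, hc.symm⟩

end

section

/-! ### Integration over the unitary group -/

instance (N : ℕ) : CompactSpace (Matrix.unitaryGroup (Fin N) ℂ) := by
  have hc : IsCompact (Set.pi Set.univ fun _ : Fin N => Set.pi Set.univ fun _ : Fin N =>
      Metric.closedBall (0 : ℂ) 1) :=
    isCompact_univ_pi fun _ => isCompact_univ_pi fun _ => isCompact_closedBall _ _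
  have hclosed : IsClosed (Matrix.unitaryGroup (Fin N) ℂ : Set (Matrix (Fin N) (Fin N) ℂ)) := by
    have : (Matrix.unitaryGroup (Fin N) ℂ : Set (Matrix (Fin N) (Fin N) ℂ)) =
        {A | A * star A = 1} := by
      ext A; exact Matrix.mem_unitaryGroup_iff
    rw [this]
    exact isClosed_eq (continuous_id.mul continuous_star) continuous_const
  refine isCompact_iff_compactSpace.1 (hc.of_isClosed_subset hclosed ?_)
  intro A hA i _ j _
  simpa using entry_norm_bound_of_unitary hA i j

variable {N : ℕ}

theorem integrable_unitary (μ : Measure (Matrix.unitaryGroup (Fin N) ℂ)) [IsFiniteMeasure μ]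
    {f : Matrix.unitaryGroup (Fin N) ℂ → ℂ} (hf : Continuous f) : Integrable f μ :=
  hf.integrable_of_hasCompactSupport (HasCompactSupport.of_compactSpace f)

theorem isMulRightInvariant_unitary (μ : Measure (Matrix.unitaryGroup (Fin N) ℂ))
    [μ.IsHaarMeasure] [IsProbabilityMeasure μ] : μ.IsMulRightInvariant := by
  refine ⟨fun g => ?_⟩
  have hm : Measurable fun x : Matrix.unitaryGroup (Fin N) ℂ => x * g :=
    (continuous_mul_const g).measurable
  have : IsProbabilityMeasure (μ.map (· * g)) := Measure.isProbabilityMeasure_map hm.aemeasurable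
  have h := Measure.isMulInvariant_eq_smul_of_compactSpace (μ.map (· * g)) μ
  have h1 := congrArg (fun ν : Measure _ => ν Set.univ) h
  simp only [measure_univ, Measure.smul_apply, ENNReal.smul_def, smul_eq_mul, mul_one] at h1
  rw [h, ENNReal.coe_eq_one.1 h1.symm, one_smul]

variable {ι : Type*} [Fintype ι]

theorem continuous_tensorMat_conj (A : ι → Matrix (Fin N) (Fin N) ℂ) (i j : ι → Fin N) :
    Continuous fun U : Matrix.unitaryGroup (Fin N) ℂ =>
      tensorMat (fun s =>
        star (U : Matrix (Fin N) (Fin N) ℂ) * A s * (U : Matrix (Fin N) (Fin N) ℂ)) i j := by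
  simp only [tensorMat_apply]
  refine continuous_finsetProd _ fun s _ => ?_
  exact Continuous.matrix_elem (by fun_prop) _ _

/-- The average of the tensor product of the matrices `U* A_s U`. -/
def haarAvg (μ : Measure (Matrix.unitaryGroup (Fin N) ℂ)) (A : ι → Matrix (Fin N) (Fin N) ℂ) :
    Matrix (ι → Fin N) (ι → Fin N) ℂ :=
  Matrix.of fun i j => ∫ U, tensorMat (fun s =>
    star (U : Matrix (Fin N) (Fin N) ℂ) * A s * (U : Matrix (Fin N) (Fin N) ℂ)) i j ∂μ

variable [DecidableEq ι]

theorem trace_haarAvg_mul (μ : Measure (Matrix.unitaryGroup (Fin N) ℂ)) [IsFiniteMeasure μ]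
    (A : ι → Matrix (Fin N) (Fin N) ℂ) (Y : Matrix (ι → Fin N) (ι → Fin N) ℂ) :
    (haarAvg μ A * Y).trace = ∫ U : Matrix.unitaryGroup (Fin N) ℂ,
      (tensorMat (fun s =>
        star (U : Matrix (Fin N) (Fin N) ℂ) * A s * (U : Matrix (Fin N) (Fin N) ℂ)) * Y).trace ∂μ := by
  simp only [Matrix.trace, Matrix.diag_apply, Matrix.mul_apply]
  have hint : ∀ i k, Integrable (fun U : Matrix.unitaryGroup (Fin N) ℂ =>
      tensorMat (fun s =>
        star (U : Matrix (Fin N) (Fin N) ℂ) * A s * (U : Matrix (Fin N) (Fin N) ℂ)) i k * Y k i) μ :=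
    fun i k => (integrable_unitary μ (continuous_tensorMat_conj A i k)).mul_const _
  rw [integral_finsetSum _ fun i _ => integrable_finsetSum _ fun k _ => hint i k]
  refine Finset.sum_congr rfl fun i _ => ?_
  rw [integral_finsetSum _ fun k _ => hint i k]
  refine Finset.sum_congr rfl fun k _ => ?_
  rw [integral_mul_const]
  rfl

theorem trace_mul_single (X : Matrix (ι → Fin N) (ι → Fin N) ℂ) (i j : ι → Fin N) :
    (X * Matrix.single j i 1).trace = X i j := by
  rw [Matrix.trace_mul_single]
  simp

theorem commute_haarAvg (μ : Measure (Matrix.unitaryGroup (Fin N) ℂ)) [μ.IsHaarMeasure]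
    [IsProbabilityMeasure μ] (A : ι → Matrix (Fin N) (Fin N) ℂ)
    (V : Matrix.unitaryGroup (Fin N) ℂ) :
    Commute (haarAvg μ A) (tensorMat fun _ => (V : Matrix (Fin N) (Fin N) ℂ)) := by
  have hinv := isMulRightInvariant_unitary μ
  have hV : tensorMat (fun _ : ι => (V : Matrix (Fin N) (Fin N) ℂ)) *
      tensorMat (fun _ => star (V : Matrix (Fin N) (Fin N) ℂ)) = 1 := by
    rw [tensorMat_mul, ← tensorMat_one]
    simp
  have key : tensorMat (fun _ => star (V : Matrix (Fin N) (Fin N) ℂ)) * haarAvg μ A *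
      tensorMat (fun _ => (V : Matrix (Fin N) (Fin N) ℂ)) = haarAvg μ A := by
    ext i j
    have htr : ∀ Z : Matrix (ι → Fin N) (ι → Fin N) ℂ,
        (tensorMat (fun _ => star (V : Matrix (Fin N) (Fin N) ℂ)) * Z *
          tensorMat (fun _ => (V : Matrix (Fin N) (Fin N) ℂ)) * Matrix.single j i 1).trace =
        (Z * (tensorMat (fun _ => (V : Matrix (Fin N) (Fin N) ℂ)) * Matrix.single j i 1 *
          tensorMat (fun _ => star (V : Matrix (Fin N) (Fin N) ℂ)))).trace := fun Z => by
      rw [mul_assoc, mul_assoc, Matrix.trace_mul_comm, mul_assoc]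
    rw [← trace_mul_single (_ * _), ← trace_mul_single (haarAvg μ A), htr, trace_haarAvg_mul,
      trace_haarAvg_mul]
    conv_rhs => rw [← integral_mul_right_eq_self _ V]
    refine integral_congr_ae (Filter.Eventually.of_forall fun U => ?_)
    dsimp only
    rw [← htr, tensorMat_mul, tensorMat_mul]
    congr 3
    ext s : 1
    simp [mul_assoc]
  calc haarAvg μ A * tensorMat (fun _ => (V : Matrix (Fin N) (Fin N) ℂ))
      = tensorMat (fun _ => (V : Matrix (Fin N) (Fin N) ℂ)) *
        (tensorMat (fun _ => star (V : Matrix (Fin N) (Fin N) ℂ)) * haarAvg μ A *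
          tensorMat (fun _ => (V : Matrix (Fin N) (Fin N) ℂ))) := by
        rw [← mul_assoc, ← mul_assoc, hV, one_mul]
    _ = _ := by rw [key]

theorem trSum_eq_trace (σ : Equiv.Perm ι) (A : ι → Matrix (Fin N) (Fin N) ℂ) :
    trSum σ A = (tensorMat A * permMat N σ⁻¹).trace := by
  rw [trSum, Matrix.trace]
  refine Finset.sum_congr rfl fun i _ => ?_
  rw [Matrix.diag_apply, mul_permMat_apply, tensorMat_apply]
  rfl

theorem trSum_conj (σ : Equiv.Perm ι) (A : ι → Matrix (Fin N) (Fin N) ℂ)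
    (U : Matrix.unitaryGroup (Fin N) ℂ) :
    trSum σ (fun s => star (U : Matrix (Fin N) (Fin N) ℂ) *
      A s * (U : Matrix (Fin N) (Fin N) ℂ)) = trSum σ A := by
  have h1 := permMat_conj_tensorMat σ⁻¹ (fun _ : ι => (U : Matrix (Fin N) (Fin N) ℂ))
  have h2 : tensorMat (fun _ : ι => (U : Matrix (Fin N) (Fin N) ℂ)) * permMat N σ⁻¹ =
      permMat N σ⁻¹ * tensorMat (fun _ : ι => (U : Matrix (Fin N) (Fin N) ℂ)) := by
    conv_lhs => rw [show tensorMat (fun _ : ι => (U : Matrix (Fin N) (Fin N) ℂ)) =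
      permMat N σ⁻¹ * tensorMat (fun _ : ι => (U : Matrix (Fin N) (Fin N) ℂ)) * permMat N σ⁻¹⁻¹
      from h1.symm]
    rw [mul_assoc, permMat_mul, inv_mul_cancel, permMat_one, mul_one]
  have hU : tensorMat (fun _ : ι => (U : Matrix (Fin N) (Fin N) ℂ)) *
      tensorMat (fun _ => star (U : Matrix (Fin N) (Fin N) ℂ)) = 1 := by
    rw [tensorMat_mul, ← tensorMat_one]
    simp
  rw [trSum_eq_trace, trSum_eq_trace, ← tensorMat_mul, ← tensorMat_mul, mul_assoc, h2, mul_assoc,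
    Matrix.trace_mul_comm, mul_assoc, mul_assoc, hU, mul_one]

theorem trace_haarAvg_mul_permMat (μ : Measure (Matrix.unitaryGroup (Fin N) ℂ))
    [IsProbabilityMeasure μ] (A : ι → Matrix (Fin N) (Fin N) ℂ) (σ : Equiv.Perm ι) :
    (haarAvg μ A * permMat N σ⁻¹).trace = trSum σ A := by
  rw [trace_haarAvg_mul]
  simp only [← trSum_eq_trace, trSum_conj]
  simp

/-- The expectation of `tr_N (A₁ U B₁ U* ⋯ A_n U B_n U*)`. -/
def mixedMoment {n : ℕ} (μ : Measure (Matrix.unitaryGroup (Fin N) ℂ))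
    (A B : Fin n → Matrix (Fin N) (Fin N) ℂ) : ℂ :=
  ∫ U : Matrix.unitaryGroup (Fin N) ℂ, normTrace (List.ofFn fun s =>
    A s * ((U : Matrix (Fin N) (Fin N) ℂ) * B s * star (U : Matrix (Fin N) (Fin N) ℂ))).prod ∂μ

theorem trace_prod_conj {n : ℕ} (hn : 0 < n) (A B : Fin n → Matrix (Fin N) (Fin N) ℂ)
    (U : Matrix.unitaryGroup (Fin N) ℂ) :
    (List.ofFn fun s => A s * ((U : Matrix (Fin N) (Fin N) ℂ) * B s *
      star (U : Matrix (Fin N) (Fin N) ℂ))).prod.trace =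
    (tensorMat (fun s => star (U : Matrix (Fin N) (Fin N) ℂ) *
      A s * (U : Matrix (Fin N) (Fin N) ℂ)) *
      (tensorMat B * permMat N (finRotate n)⁻¹)).trace := by
  have h1 : (List.ofFn fun s => A s * ((U : Matrix (Fin N) (Fin N) ℂ) * B s *
      star (U : Matrix (Fin N) (Fin N) ℂ))) =
      (List.ofFn fun s => star (U : Matrix (Fin N) (Fin N) ℂ) *
        A s * (U : Matrix (Fin N) (Fin N) ℂ) * B s).map
        (Unitary.conjStarAlgAut ℂ (Matrix (Fin N) (Fin N) ℂ) U) := by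
    rw [List.map_ofFn]
    congr 1
    ext s : 1
    simp only [Function.comp_apply, Unitary.conjStarAlgAut_apply]
    simp only [← mul_assoc]
    simp
  rw [h1, ← map_list_prod, Unitary.conjStarAlgAut_apply, Matrix.trace_mul_comm, ← mul_assoc]
  rw [show star (U : Matrix (Fin N) (Fin N) ℂ) * U = 1 by simp, one_mul, trace_prod_ofFn hn,
    trSum_eq_trace, ← mul_assoc, tensorMat_mul]

theorem mixedMoment_eq {n : ℕ} (hn : 0 < n) (μ : Measure (Matrix.unitaryGroup (Fin N) ℂ))
    [IsFiniteMeasure μ] (A B : Fin n → Matrix (Fin N) (Fin N) ℂ) :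
    mixedMoment μ A B =
      (N : ℂ)⁻¹ * (haarAvg μ A * (tensorMat B * permMat N (finRotate n)⁻¹)).trace := by
  rw [trace_haarAvg_mul, ← integral_const_mul]
  refine integral_congr_ae (Filter.Eventually.of_forall fun U => ?_)
  simp only [normTrace, LinearMap.smul_apply, Matrix.traceLinearMap_apply, smul_eq_mul]
  rw [trace_prod_conj hn]

end

section

/-! ### The expansion of mixed moments -/

theorem exists_generalized_inverse {m : Type*} [Fintype m] [DecidableEq m] (Γ : Matrix m m ℂ) :
    ∃ W : Matrix m m ℂ, Γ * W * Γ = Γ := by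
  let f := Matrix.toLin' Γ
  obtain ⟨s, hs⟩ := f.rangeRestrict.exists_rightInverse_of_surjective f.range_rangeRestrict
  obtain ⟨g, hg⟩ := LinearMap.exists_extend s
  refine ⟨LinearMap.toMatrix' g, ?_⟩
  apply Matrix.toLin'.injective
  rw [Matrix.toLin'_mul, Matrix.toLin'_mul, Matrix.toLin'_toMatrix']
  ext1 i
  ext1
  have h1 : g (f (Pi.single i 1)) = s (f.rangeRestrict (Pi.single i 1)) :=
    LinearMap.congr_fun hg (f.rangeRestrict (Pi.single i 1))
  have h2 := congrArg Subtype.val (LinearMap.congr_fun hs (f.rangeRestrict (Pi.single i 1)))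
  simp only [LinearMap.comp_apply, LinearMap.id_apply] at h2
  change (f (g (f (Pi.single i 1)))) = f (Pi.single i 1)
  rw [h1]
  exact h2

variable {N : ℕ}

theorem trace_permMat {n : ℕ} (hN : N ≠ 0) (σ : Equiv.Perm (Fin n)) :
    (permMat N σ).trace = (N : ℂ) ^ numCycles σ := by
  have h := trSum_eq_trace σ⁻¹ (fun _ => (1 : Matrix (Fin N) (Fin N) ℂ))
  rw [tensorMat_one, one_mul, inv_inv, trSum_eq hN, permTrace_one hN, mul_one,
    numCycles_inv] at h
  exact h.symm

theorem conjTranspose_permMat {ι : Type*} [Fintype ι] [DecidableEq ι] (σ : Equiv.Perm ι) :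
    (permMat N σ).conjTranspose = permMat N σ⁻¹ := by
  ext i k
  rw [Matrix.conjTranspose_apply, permMat_apply, permMat_apply]
  have : i = k ∘ σ ↔ k = i ∘ σ.symm := by
    rw [Equiv.eq_comp_symm, eq_comm]
  simp [this, apply_ite star, Equiv.Perm.inv_def]

open scoped ComplexOrder in
theorem sum_permMat_eq_zero {ι : Type*} [Fintype ι] [DecidableEq ι] {d : Equiv.Perm ι → ℂ}
    (h : ∀ σ, ((∑ α, d α • permMat N α) * permMat N σ⁻¹).trace = 0) :
    ∑ α, d α • permMat N α = 0 := by
  rw [← Matrix.trace_mul_conjTranspose_self_eq_zero_iff]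
  rw [Matrix.conjTranspose_sum]
  rw [Matrix.mul_sum, Matrix.trace_sum]
  refine Finset.sum_eq_zero fun σ _ => ?_
  rw [Matrix.conjTranspose_smul, conjTranspose_permMat, Matrix.mul_smul, Matrix.trace_smul, h,
    smul_zero]

theorem cast_pow_numCycles {n : ℕ} (hN : N ≠ 0) (σ : Equiv.Perm (Fin n)) :
    (N : ℂ) ^ numCycles σ = (N : ℂ) ^ n * (N : ℂ)⁻¹ ^ permLength σ := by
  have h : (N : ℂ) ≠ 0 := by exact_mod_cast hN
  have h1 : (N : ℂ) ^ n = (N : ℂ) ^ permLength σ * (N : ℂ) ^ numCycles σ := by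
    rw [← pow_add, permLength_add_numCycles]
  rw [h1, mul_right_comm, ← mul_pow, mul_inv_cancel₀ h, one_pow, one_mul]

/-- The mixed moment in terms of weights that are bounded by the traces of the first tuple. -/
theorem exists_weights (n : ℕ) (hn : 0 < n) (hN : N ≠ 0) : ∃ C : ℝ, 0 ≤ C ∧
    ∀ (μ : Measure (Matrix.unitaryGroup (Fin N) ℂ)) [μ.IsHaarMeasure] [IsProbabilityMeasure μ]
      (A : Fin n → Matrix (Fin N) (Fin N) ℂ) (a : ℝ), (∀ σ, ‖permTrace σ A‖ ≤ a) →
    ∃ w : Equiv.Perm (Fin n) → ℂ,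
      (∀ σ, permTrace σ A = ∑ α, (N : ℂ)⁻¹ ^ defect α σ * w α) ∧
      (∀ B, mixedMoment μ A B = ∑ α, (N : ℂ)⁻¹ ^ defect α (finRotate n) * w α *
        permTrace (α⁻¹ * finRotate n) B) ∧
      ∀ α, ‖w α‖ ≤ C * a := by
  have hN' : (N : ℂ) ≠ 0 := by exact_mod_cast hN
  let Γ : Matrix (Equiv.Perm (Fin n)) (Equiv.Perm (Fin n)) ℂ :=
    Matrix.of fun σ α => (permMat N α * permMat N σ⁻¹).trace
  obtain ⟨W, hW⟩ := exists_generalized_inverse Γ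
  refine ⟨(N : ℝ) ^ n * ∑ α, ∑ σ, ‖W α σ‖ * (N : ℝ) ^ n, by positivity, ?_⟩
  intro μ _ _ A a ha
  obtain ⟨c, hc⟩ := exists_eq_sum_permMat (commute_haarAvg μ A)
  have hΓ : ∀ (d : Equiv.Perm (Fin n) → ℂ) σ,
      ((∑ α, d α • permMat N α) * permMat N σ⁻¹).trace = Γ.mulVec d σ := by
    intro d σ
    rw [Finset.sum_mul, Matrix.trace_sum]
    refine Finset.sum_congr rfl fun α _ => ?_
    rw [Matrix.smul_mul, Matrix.trace_smul, smul_eq_mul, mul_comm]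
    rfl
  have ht : ∀ σ, trSum σ A = Γ.mulVec c σ := fun σ => by
    rw [← hΓ, ← hc, trace_haarAvg_mul_permMat]
  let c' := W.mulVec fun σ => trSum σ A
  have hc' : haarAvg μ A = ∑ α, c' α • permMat N α := by
    rw [hc, ← sub_eq_zero, ← Finset.sum_sub_distrib]
    simp only [← sub_smul]
    refine sum_permMat_eq_zero (d := fun α => c α - c' α) fun σ => ?_
    rw [hΓ]
    have h1 : c' = W.mulVec (Γ.mulVec c) := by
      simp only [c']
      congr 1
      ext σ
      exact ht σ
    have h2 : (fun α => c α - c' α) = c - c' := rfl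
    rw [h2, Matrix.mulVec_sub, h1, Matrix.mulVec_mulVec, Matrix.mulVec_mulVec, hW,
      sub_self]
    rfl
  have hlen : ∀ α σ : Equiv.Perm (Fin n), (N : ℂ)⁻¹ ^ defect α σ * (N : ℂ)⁻¹ ^ permLength σ =
      (N : ℂ)⁻¹ ^ permLength α * (N : ℂ)⁻¹ ^ permLength (α⁻¹ * σ) := by
    intro α σ
    rw [← pow_add, ← pow_add, defect_add]
  have hinv : ∀ m, (N : ℂ) ^ m * (N : ℂ)⁻¹ ^ m = 1 := fun m => by
    rw [← mul_pow, mul_inv_cancel₀ hN', one_pow]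
  refine ⟨fun α => (N : ℂ) ^ permLength α * c' α, fun σ => ?_, fun B => ?_, fun α => ?_⟩
  · have h1 : trSum σ A = ∑ α, c' α * (N : ℂ) ^ numCycles (α⁻¹ * σ) := by
      rw [← trace_haarAvg_mul_permMat μ, hc', hΓ]
      refine Finset.sum_congr rfl fun α _ => ?_
      rw [mul_comm]
      congr 1
      change (permMat N α * permMat N σ⁻¹).trace = _
      rw [permMat_mul, trace_permMat hN, ← numCycles_inv, mul_inv_rev, inv_inv,
        numCycles_mul_comm]
    rw [trSum_eq hN] at h1
    have h2 : permTrace σ A = (N : ℂ) ^ n * (N : ℂ)⁻¹ ^ n * ((N : ℂ) ^ permLength σ *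
        (N : ℂ)⁻¹ ^ permLength σ) * permTrace σ A := by rw [hinv, hinv]; ring
    calc permTrace σ A = (N : ℂ)⁻¹ ^ n * (N : ℂ) ^ permLength σ *
          ((N : ℂ) ^ numCycles σ * permTrace σ A) := by
          rw [cast_pow_numCycles hN]
          linear_combination h2
      _ = _ := by
        rw [h1, Finset.mul_sum]
        refine Finset.sum_congr rfl fun α _ => ?_
        rw [cast_pow_numCycles hN]
        linear_combination (-(N : ℂ) ^ permLength σ * (N : ℂ) ^ permLength α * c' α) * hlen α σ +
          (N : ℂ) ^ permLength σ * (N : ℂ)⁻¹ ^ permLength (α⁻¹ * σ) * c' α * hinv n -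
          (N : ℂ) ^ permLength σ * (N : ℂ)⁻¹ ^ permLength (α⁻¹ * σ) * c' α * hinv (permLength α) +
          (N : ℂ) ^ permLength α * (N : ℂ)⁻¹ ^ defect α σ * c' α * hinv (permLength σ)
  · rw [mixedMoment_eq hn, hc', Finset.sum_mul, Matrix.trace_sum, Finset.mul_sum]
    refine Finset.sum_congr rfl fun α _ => ?_
    have h1 : (permMat N α * (tensorMat B * permMat N (finRotate n)⁻¹)).trace =
        trSum (α⁻¹ * finRotate n) B := by
      rw [Matrix.trace_mul_comm, mul_assoc, permMat_mul, trSum_eq_trace, mul_inv_rev, inv_inv]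
    rw [Matrix.smul_mul, Matrix.trace_smul, h1, smul_eq_mul, trSum_eq hN, cast_pow_numCycles hN]
    have h2 := hlen α (finRotate n)
    have h3 : (N : ℂ) ^ n * (N : ℂ)⁻¹ = (N : ℂ) ^ permLength (finRotate n) := by
      have h4 := permLength_add_numCycles (finRotate n)
      rw [numCycles_finRotate hn] at h4
      nth_rw 1 [← h4]
      rw [pow_succ]
      field_simp
    linear_combination (c' α * (N : ℂ)⁻¹ ^ permLength (α⁻¹ * finRotate n) *
      permTrace (α⁻¹ * finRotate n) B) * h3 -
      (c' α * permTrace (α⁻¹ * finRotate n) B * (N : ℂ) ^ permLength (finRotate n) *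
        (N : ℂ) ^ permLength α) * h2 +
      (c' α * permTrace (α⁻¹ * finRotate n) B * (N : ℂ) ^ permLength α *
        (N : ℂ)⁻¹ ^ defect α (finRotate n)) * hinv (permLength (finRotate n)) -
      (c' α * permTrace (α⁻¹ * finRotate n) B * (N : ℂ) ^ permLength (finRotate n) *
        (N : ℂ)⁻¹ ^ permLength (α⁻¹ * finRotate n)) * hinv (permLength α)
  · have ha0 : 0 ≤ a := (norm_nonneg _).trans (ha 1)
    have hN1 : (1 : ℝ) ≤ N := by exact_mod_cast Nat.one_le_iff_ne_zero.2 hN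
    have h1 : ‖c' α‖ ≤ (∑ σ, ‖W α σ‖ * (N : ℝ) ^ n) * a := by
      rw [Finset.sum_mul]
      refine (norm_sum_le _ _).trans (Finset.sum_le_sum fun σ _ => ?_)
      dsimp only
      rw [norm_mul, trSum_eq hN, norm_mul, norm_pow, Complex.norm_natCast, mul_assoc]
      have h3 : (N : ℝ) ^ numCycles σ ≤ (N : ℝ) ^ n := pow_le_pow_right₀ hN1 (numCycles_le σ)
      have := ha σ
      gcongr
    rw [norm_mul, norm_pow, Complex.norm_natCast, mul_assoc]
    have h2 : (∑ σ, ‖W α σ‖ * (N : ℝ) ^ n) ≤ ∑ α, ∑ σ, ‖W α σ‖ * (N : ℝ) ^ n :=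
      Finset.single_le_sum (f := fun α => ∑ σ, ‖W α σ‖ * (N : ℝ) ^ n)
        (fun _ _ => by positivity) (Finset.mem_univ α)
    have h3 : (N : ℝ) ^ permLength α ≤ (N : ℝ) ^ n :=
      pow_le_pow_right₀ hN1 (Nat.sub_le _ _)
    have h4 := h1.trans (mul_le_mul_of_nonneg_right h2 ha0)
    gcongr

/-- The truncation of a polynomial at order `K`. -/
theorem norm_sum_pow_sub_le {I : Type*} (s : Finset I) (d : I → ℕ) (a : I → ℂ) (K : ℕ) {x : ℂ}
    (hx : ‖x‖ ≤ 1) :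
    ‖∑ i ∈ s, x ^ d i * a i - ∑ h ∈ Finset.range (K + 1), x ^ h * ∑ i ∈ s with d i = h, a i‖ ≤
      ‖x‖ ^ (K + 1) * ∑ i ∈ s, ‖a i‖ := by
  have h1 : ∑ h ∈ Finset.range (K + 1), x ^ h * ∑ i ∈ s with d i = h, a i =
      ∑ i ∈ s, if d i < K + 1 then x ^ d i * a i else 0 := by
    simp only [Finset.mul_sum, Finset.sum_filter]
    rw [Finset.sum_comm]
    refine Finset.sum_congr rfl fun i _ => ?_
    simp only [mul_ite, mul_zero]
    rw [Finset.sum_ite_eq]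
    simp
  rw [h1, ← Finset.sum_sub_distrib, Finset.mul_sum]
  refine (norm_sum_le _ _).trans (Finset.sum_le_sum fun i _ => ?_)
  split_ifs with h
  · rw [sub_self, norm_zero]; positivity
  · rw [sub_zero, norm_mul, norm_pow]
    exact mul_le_mul_of_nonneg_right (pow_le_pow_of_le_one (norm_nonneg _) hx (by omega))
      (norm_nonneg _)

/-- Weights are recovered from traces by the truncated inverse. -/
theorem norm_weight_sub_le {n : ℕ} (K : ℕ) {x : ℂ} (hx : ‖x‖ ≤ 1)
    (w t : Equiv.Perm (Fin n) → ℂ) (ht : ∀ σ, t σ = ∑ α, x ^ (defect α σ / 2) * w α) {b : ℝ}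
    (hw : ∀ α, ‖w α‖ ≤ b) (σ : Equiv.Perm (Fin n)) :
    ‖w σ - ∑ g ∈ Finset.range (K + 1), x ^ g * ∑ α, (cumulantMatrix n g σ α : ℂ) * t α‖ ≤
      (Fintype.card (Equiv.Perm (Fin n)) * ∑ p ∈ Finset.range (K + 1) ×ˢ Finset.univ,
        ‖(cumulantMatrix n p.1 σ p.2 : ℂ)‖) * ‖x‖ ^ (K + 1) * b := by
  have h1 : ∀ β, ∑ h ∈ Finset.range (K + 1), x ^ h *
      ∑ p ∈ Finset.range (K + 1) ×ˢ (Finset.univ : Finset (Equiv.Perm (Fin n))) with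
        p.1 + defect β p.2 / 2 = h, (cumulantMatrix n p.1 σ p.2 : ℂ) = if β = σ then 1 else 0 := by
    intro β
    have h2 : ∀ h ∈ Finset.range (K + 1),
        ∑ p ∈ Finset.range (K + 1) ×ˢ (Finset.univ : Finset (Equiv.Perm (Fin n))) with
          p.1 + defect β p.2 / 2 = h, (cumulantMatrix n p.1 σ p.2 : ℂ) =
        if h = 0 then (if β = σ then 1 else 0) else 0 := by
      intro h hh
      have hh' : h ≤ K := by simpa [Nat.lt_succ_iff] using hh
      have key := congrArg (fun m : Matrix (Equiv.Perm (Fin n)) (Equiv.Perm (Fin n)) ℤ =>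
        (m σ β : ℂ)) (sum_cumulantMatrix_mul_defectMatrix n h)
      rw [Finset.Nat.sum_antidiagonal_eq_sum_range_succ_mk] at key
      have hr : (((if h = 0 then (1 : Matrix (Equiv.Perm (Fin n)) (Equiv.Perm (Fin n)) ℤ)
          else 0) σ β : ℤ) : ℂ) = if h = 0 then (if β = σ then 1 else 0) else 0 := by
        split_ifs with _ h2
        · subst h2; simp
        · rw [Matrix.one_apply_ne (Ne.symm h2)]; simp
        · simp
      dsimp only at key
      rw [hr] at key
      rw [← key, Finset.sum_filter, Finset.sum_product]
      simp only [Matrix.sum_apply, Matrix.mul_apply, Int.cast_sum]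
      have hsub : Finset.range (h + 1) ⊆ Finset.range (K + 1) := by
        intro y; simp only [Finset.mem_range]; omega
      rw [← Finset.sum_subset hsub]
      · refine Finset.sum_congr rfl fun g hg => Finset.sum_congr rfl fun α _ => ?_
        have hg' : g ≤ h := by simpa [Nat.lt_succ_iff] using hg
        obtain ⟨e, he⟩ := (even_defect β α).two_dvd
        rw [defectMatrix_apply, he, Nat.mul_div_cancel_left _ two_pos]
        by_cases hge : g + e = h
        · rw [if_pos hge, if_pos (by omega)]; simp
        · rw [if_neg hge, if_neg (by omega)]; simp
      · intro g _ hg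
        refine Finset.sum_eq_zero fun α _ => if_neg ?_
        simp only [Finset.mem_range] at hg
        omega
    rw [Finset.sum_congr rfl fun h hh => by rw [h2 h hh]]
    rw [Finset.sum_eq_single_of_mem 0 (by simp)]
    · simp
    · intro h _ hne; simp [hne]
  have h3 : ∑ g ∈ Finset.range (K + 1), x ^ g * ∑ α, (cumulantMatrix n g σ α : ℂ) * t α =
      ∑ β, w β * ∑ p ∈ Finset.range (K + 1) ×ˢ (Finset.univ : Finset (Equiv.Perm (Fin n))),
        x ^ (p.1 + defect β p.2 / 2) * (cumulantMatrix n p.1 σ p.2 : ℂ) := by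
    simp only [ht, Finset.mul_sum, Finset.sum_product]
    conv_rhs => rw [Finset.sum_comm]
    refine Finset.sum_congr rfl fun g _ => ?_
    rw [Finset.sum_comm]
    refine Finset.sum_congr rfl fun β _ => Finset.sum_congr rfl fun α _ => ?_
    rw [pow_add]
    ring
  have h4 : w σ = ∑ β, w β * ∑ h ∈ Finset.range (K + 1), x ^ h *
      ∑ p ∈ Finset.range (K + 1) ×ˢ (Finset.univ : Finset (Equiv.Perm (Fin n))) with
        p.1 + defect β p.2 / 2 = h, (cumulantMatrix n p.1 σ p.2 : ℂ) := by
    simp [h1]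
  rw [h3, h4, ← Finset.sum_sub_distrib]
  have hb : 0 ≤ b := (norm_nonneg _).trans (hw 1)
  have h5 : ∀ β ∈ (Finset.univ : Finset (Equiv.Perm (Fin n))), ‖w β *
    ∑ h ∈ Finset.range (K + 1), x ^ h *
      ∑ p ∈ Finset.range (K + 1) ×ˢ (Finset.univ : Finset (Equiv.Perm (Fin n))) with
        p.1 + defect β p.2 / 2 = h, (cumulantMatrix n p.1 σ p.2 : ℂ) -
      w β * ∑ p ∈ Finset.range (K + 1) ×ˢ (Finset.univ : Finset (Equiv.Perm (Fin n))),
        x ^ (p.1 + defect β p.2 / 2) * (cumulantMatrix n p.1 σ p.2 : ℂ)‖ ≤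
      (∑ p ∈ Finset.range (K + 1) ×ˢ Finset.univ,
        ‖(cumulantMatrix n p.1 σ p.2 : ℂ)‖) * ‖x‖ ^ (K + 1) * b := by
    intro β _
    have h6 := norm_sum_pow_sub_le
      (Finset.range (K + 1) ×ˢ (Finset.univ : Finset (Equiv.Perm (Fin n))))
      (fun p => p.1 + defect β p.2 / 2) (fun p => (cumulantMatrix n p.1 σ p.2 : ℂ)) K hx
    rw [norm_sub_rev] at h6
    rw [← mul_sub, norm_mul]
    refine (mul_le_mul (hw β) h6 (norm_nonneg _) hb).trans (le_of_eq ?_)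
    ring
  refine (norm_sum_le _ _).trans ((Finset.sum_le_sum h5).trans (le_of_eq ?_))
  rw [Finset.sum_const, Finset.card_univ, nsmul_eq_mul]
  ring

end

theorem norm_natCast_inv_sq_le {N : ℕ} : ‖((N : ℂ) ^ 2)⁻¹‖ ≤ 1 := by
  rw [norm_inv, norm_pow, Complex.norm_natCast]
  rcases Nat.eq_zero_or_pos N with rfl | h
  · simp
  · exact inv_le_one_of_one_le₀ (one_le_pow₀ (by exact_mod_cast h))

theorem inv_pow_defect {n : ℕ} (N : ℕ) (α β : Equiv.Perm (Fin n)) :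
    (N : ℂ)⁻¹ ^ defect α β = ((N : ℂ) ^ 2)⁻¹ ^ (defect α β / 2) := by
  rw [← inv_pow, ← pow_mul, Nat.mul_div_cancel' (even_defect α β).two_dvd]

/-- For large `N` the weights are bounded by the traces, uniformly in `N`. -/
theorem exists_weight_bound (n : ℕ) : ∃ (C : ℝ) (N₀ : ℕ), 0 ≤ C ∧ ∀ N : ℕ, N₀ ≤ N → N ≠ 0 →
    ∀ (w t : Equiv.Perm (Fin n) → ℂ), (∀ σ, t σ = ∑ α, (N : ℂ)⁻¹ ^ defect α σ * w α) →
    ∀ a : ℝ, (∀ σ, ‖t σ‖ ≤ a) → ∀ α, ‖w α‖ ≤ C * a := by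
  let E : Equiv.Perm (Fin n) → ℝ := fun σ => Fintype.card (Equiv.Perm (Fin n)) *
    ∑ p ∈ Finset.range (0 + 1) ×ˢ Finset.univ, ‖(cumulantMatrix n p.1 σ p.2 : ℂ)‖
  have hE : ∀ σ, 0 ≤ E σ := fun σ => by positivity
  let D : ℝ := ∑ σ, E σ
  have hD : ∀ σ, E σ ≤ D := fun σ =>
    Finset.single_le_sum (f := E) (fun _ _ => hE _) (Finset.mem_univ σ)
  let c : ℝ := ∑ σ : Equiv.Perm (Fin n), ∑ α, ‖(cumulantMatrix n 0 σ α : ℂ)‖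
  refine ⟨2 * c, ⌈2 * D⌉₊, by positivity, fun N hN hN0 w t ht a ha => ?_⟩
  obtain ⟨σ, -, hσ⟩ := Finset.exists_max_image Finset.univ (fun σ => ‖w σ‖)
    ⟨(1 : Equiv.Perm (Fin n)), Finset.mem_univ _⟩
  have ha0 : 0 ≤ a := (norm_nonneg _).trans (ha 1)
  have h1 := norm_weight_sub_le 0 (x := ((N : ℂ) ^ 2)⁻¹) norm_natCast_inv_sq_le w t
    (fun σ => by rw [ht]; simp only [inv_pow_defect]) (fun α => hσ α (Finset.mem_univ _)) σ
  simp only [zero_add, Finset.range_one, Finset.sum_singleton, pow_zero, one_mul, pow_one] at h1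
  have h2 : ‖∑ α, (cumulantMatrix n 0 σ α : ℂ) * t α‖ ≤ c * a := by
    refine (norm_sum_le _ _).trans ?_
    have h3 : ∑ α, ‖(cumulantMatrix n 0 σ α : ℂ)‖ ≤ c :=
      Finset.single_le_sum (f := fun σ => ∑ α, ‖(cumulantMatrix n 0 σ α : ℂ)‖)
        (fun _ _ => by positivity) (Finset.mem_univ σ)
    refine le_trans ?_ (mul_le_mul_of_nonneg_right h3 ha0)
    rw [Finset.sum_mul]
    refine Finset.sum_le_sum fun α _ => ?_
    rw [norm_mul]
    exact mul_le_mul_of_nonneg_left (ha α) (norm_nonneg _)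
  have hN1 : (1 : ℝ) ≤ N := by exact_mod_cast Nat.one_le_iff_ne_zero.2 hN0
  have hx : D * ‖((N : ℂ) ^ 2)⁻¹‖ ≤ 1 / 2 := by
    rw [norm_inv, norm_pow, Complex.norm_natCast]
    have h4 : 2 * D ≤ N := (Nat.le_ceil _).trans (by exact_mod_cast hN)
    rw [← div_eq_mul_inv, div_le_iff₀ (by positivity)]
    nlinarith
  have h5 : ‖w σ‖ ≤ ‖∑ α, (cumulantMatrix n 0 σ α : ℂ) * t α‖ +
      ‖w σ - ∑ α, (cumulantMatrix n 0 σ α : ℂ) * t α‖ := by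
    have := norm_add_le (∑ α, (cumulantMatrix n 0 σ α : ℂ) * t α)
      (w σ - ∑ α, (cumulantMatrix n 0 σ α : ℂ) * t α)
    rwa [add_sub_cancel] at this
  have h6 : ‖w σ - ∑ α, (cumulantMatrix n 0 σ α : ℂ) * t α‖ ≤ 1 / 2 * ‖w σ‖ := by
    refine h1.trans (mul_le_mul_of_nonneg_right (le_trans ?_ hx) (norm_nonneg _))
    have := hD σ
    simp only [E, zero_add, Finset.range_one] at this
    gcongr
  intro α
  have := hσ α (Finset.mem_univ _)
  linarith

/-- The mixed moment in terms of weights, with a bound that does not depend on `N`. -/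
theorem exists_uniform_weights (n : ℕ) (hn : 0 < n) : ∃ C : ℝ, 0 ≤ C ∧ ∀ N : ℕ, N ≠ 0 →
    ∀ (μ : Measure (Matrix.unitaryGroup (Fin N) ℂ)) [μ.IsHaarMeasure] [IsProbabilityMeasure μ]
      (A : Fin n → Matrix (Fin N) (Fin N) ℂ) (a : ℝ), (∀ σ, ‖permTrace σ A‖ ≤ a) →
    ∃ w : Equiv.Perm (Fin n) → ℂ,
      (∀ σ, permTrace σ A = ∑ α, (N : ℂ)⁻¹ ^ defect α σ * w α) ∧
      (∀ B, mixedMoment μ A B = ∑ α, (N : ℂ)⁻¹ ^ defect α (finRotate n) * w α *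
        permTrace (α⁻¹ * finRotate n) B) ∧
      ∀ α, ‖w α‖ ≤ C * a := by
  obtain ⟨C₁, N₀, hC₁, h₁⟩ := exists_weight_bound n
  choose! C₂ hC₂ h₂ using fun (N : ℕ) (hN : N ≠ 0) => exists_weights (N := N) n hn hN
  have hpos : ∀ N, 0 ≤ |C₂ N| := fun N => abs_nonneg _
  refine ⟨C₁ + ∑ N ∈ Finset.range N₀, |C₂ N|, by positivity, fun N hN μ _ _ A a ha => ?_⟩
  have ha0 : 0 ≤ a := (norm_nonneg _).trans (ha 1)
  obtain ⟨w, hw1, hw2, hw3⟩ := h₂ N hN μ A a ha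
  refine ⟨w, hw1, hw2, fun α => ?_⟩
  have hs : 0 ≤ ∑ N ∈ Finset.range N₀, |C₂ N| := Finset.sum_nonneg fun N _ => hpos N
  by_cases hle : N₀ ≤ N
  · refine (h₁ N hle hN w _ hw1 a ha α).trans (mul_le_mul_of_nonneg_right ?_ ha0)
    linarith
  · refine (hw3 α).trans (mul_le_mul_of_nonneg_right ?_ ha0)
    have : |C₂ N| ≤ ∑ N ∈ Finset.range N₀, |C₂ N| :=
      Finset.single_le_sum (fun N _ => hpos N) (Finset.mem_range.2 (not_le.1 hle))
    linarith [le_abs_self (C₂ N)]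

/-- The expansion of the mixed moments in powers of `N⁻²`. -/
theorem mixedMoment_expansion (n : ℕ) (hn : 0 < n) (K : ℕ) : ∃ C : ℝ, 0 ≤ C ∧ ∀ N : ℕ, N ≠ 0 →
    ∀ (μ : Measure (Matrix.unitaryGroup (Fin N) ℂ)) [μ.IsHaarMeasure] [IsProbabilityMeasure μ]
      (A B : Fin n → Matrix (Fin N) (Fin N) ℂ) (a b : ℝ), (∀ σ, ‖permTrace σ A‖ ≤ a) →
      (∀ σ, ‖permTrace σ B‖ ≤ b) →
    ‖mixedMoment μ A B - ∑ g ∈ Finset.range (K + 1), ((N : ℂ) ^ 2)⁻¹ ^ g * mixedCoeff g A B‖ ≤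
      C * ‖((N : ℂ) ^ 2)⁻¹‖ ^ (K + 1) * (a * b) := by
  obtain ⟨C, hC, hw⟩ := exists_uniform_weights n hn
  let S := Equiv.Perm (Fin n)
  let E : S → ℝ := fun σ => Fintype.card S *
    ∑ p ∈ Finset.range (K + 1) ×ˢ Finset.univ, ‖(cumulantMatrix n p.1 σ p.2 : ℂ)‖
  let F : S × ℕ → ℝ := fun p => ∑ β, ‖(cumulantMatrix n p.2 p.1 β : ℂ)‖
  refine ⟨(∑ α, E α * C) + ∑ p ∈ Finset.univ ×ˢ Finset.range (K + 1), F p,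
    by positivity, fun N hN μ _ _ A B a b ha hb => ?_⟩
  have ha0 : 0 ≤ a := (norm_nonneg _).trans (ha 1)
  have hb0 : 0 ≤ b := (norm_nonneg _).trans (hb 1)
  obtain ⟨w, hw1, hw2, hw3⟩ := hw N hN μ A a ha
  set x : ℂ := ((N : ℂ) ^ 2)⁻¹ with hxdef
  have hx : ‖x‖ ≤ 1 := norm_natCast_inv_sq_le
  let u : S → ℂ := fun α => ∑ g ∈ Finset.range (K + 1), x ^ g * cumulant g α A
  have hwu : ∀ α, ‖w α - u α‖ ≤ E α * ‖x‖ ^ (K + 1) * (C * a) := fun α =>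
    norm_weight_sub_le K hx w _ (fun σ => by rw [hw1]; simp only [inv_pow_defect, hxdef]) hw3 α
  have hcum : ∀ g α, ‖cumulant g α A‖ ≤ F (α, g) * a := by
    intro g α
    simp only [F]
    rw [cumulant, Finset.sum_mul]
    refine (norm_sum_le _ _).trans (Finset.sum_le_sum fun β _ => ?_)
    rw [norm_mul]
    exact mul_le_mul_of_nonneg_left (ha β) (norm_nonneg _)
  have hE0 : ∀ α, 0 ≤ E α := fun α => by positivity
  have hF0 : ∀ p, 0 ≤ F p := fun p => by positivity
  clear_value E F
  have h1 : mixedMoment μ A B = ∑ α, x ^ (defect α (finRotate n) / 2) * (w α - u α) *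
      permTrace (α⁻¹ * finRotate n) B + ∑ p ∈ Finset.univ ×ˢ Finset.range (K + 1),
        x ^ (p.2 + defect p.1 (finRotate n) / 2) *
          (cumulant p.2 p.1 A * permTrace (p.1⁻¹ * finRotate n) B) := by
    rw [hw2, Finset.sum_product, ← Finset.sum_add_distrib]
    refine Finset.sum_congr rfl fun α _ => ?_
    have : ∑ g ∈ Finset.range (K + 1), x ^ (g + defect α (finRotate n) / 2) *
        (cumulant g α A * permTrace (α⁻¹ * finRotate n) B) =
        x ^ (defect α (finRotate n) / 2) * u α * permTrace (α⁻¹ * finRotate n) B := by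
      simp only [u, Finset.mul_sum, Finset.sum_mul]
      refine Finset.sum_congr rfl fun g _ => ?_
      rw [pow_add]; ring
    rw [this, inv_pow_defect]
    ring
  have h2 : ∀ h ∈ Finset.range (K + 1), ∑ p ∈ Finset.univ ×ˢ Finset.range (K + 1) with
      p.2 + defect p.1 (finRotate n) / 2 = h,
        cumulant p.2 p.1 A * permTrace (p.1⁻¹ * finRotate n) B = mixedCoeff h A B := by
    intro h hh
    have hh' : h ≤ K := by simpa [Nat.lt_succ_iff] using hh
    rw [mixedCoeff_eq_sum_range, Finset.sum_filter, Finset.sum_product]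
    refine Finset.sum_congr rfl fun α _ => ?_
    rw [← Finset.sum_filter]
    refine Finset.sum_congr ?_ fun _ _ => rfl
    obtain ⟨e, he⟩ := (even_defect α (finRotate n)).two_dvd
    ext g
    simp only [Finset.mem_filter, Finset.mem_range, he, Nat.mul_div_cancel_left _ two_pos]
    omega
  have h3 := norm_sum_pow_sub_le ((Finset.univ : Finset S) ×ˢ Finset.range (K + 1))
    (fun p => p.2 + defect p.1 (finRotate n) / 2)
    (fun p => cumulant p.2 p.1 A * permTrace (p.1⁻¹ * finRotate n) B) K hx
  have hsum := Finset.sum_congr (g := fun h => x ^ h * mixedCoeff h A B) rfl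
    fun h hh => congrArg (x ^ h * ·) (h2 h hh)
  rw [hsum] at h3
  have h4 : ∑ p ∈ (Finset.univ : Finset S) ×ˢ Finset.range (K + 1),
      ‖cumulant p.2 p.1 A * permTrace (p.1⁻¹ * finRotate n) B‖ ≤
      (∑ p ∈ (Finset.univ : Finset S) ×ˢ Finset.range (K + 1), F p) * (a * b) := by
    rw [Finset.sum_mul]
    refine Finset.sum_le_sum fun p _ => ?_
    rw [norm_mul, ← mul_assoc]
    exact mul_le_mul (hcum p.2 p.1) (hb _) (norm_nonneg _) (mul_nonneg (hF0 _) ha0)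
  have h5 : ‖∑ α, x ^ (defect α (finRotate n) / 2) * (w α - u α) *
      permTrace (α⁻¹ * finRotate n) B‖ ≤ (∑ α, E α * C) * ‖x‖ ^ (K + 1) * (a * b) := by
    rw [Finset.sum_mul, Finset.sum_mul]
    refine (norm_sum_le _ _).trans (Finset.sum_le_sum fun α _ => ?_)
    rw [norm_mul, norm_mul, norm_pow]
    have h6 : ‖x‖ ^ (defect α (finRotate n) / 2) ≤ 1 := pow_le_one₀ (norm_nonneg _) hx
    calc ‖x‖ ^ (defect α (finRotate n) / 2) * ‖w α - u α‖ * ‖permTrace (α⁻¹ * finRotate n) B‖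
        ≤ 1 * (E α * ‖x‖ ^ (K + 1) * (C * a)) * b := by
          have h8 := hwu α
          have h9 := hb (α⁻¹ * finRotate n)
          have h10 := hE0 α
          gcongr
      _ = _ := by ring
  rw [h1, add_sub_assoc]
  refine (norm_add_le _ _).trans ?_
  have h7 : ‖x‖ ^ (K + 1) * ∑ p ∈ (Finset.univ : Finset S) ×ˢ Finset.range (K + 1),
      ‖cumulant p.2 p.1 A * permTrace (p.1⁻¹ * finRotate n) B‖ ≤ ‖x‖ ^ (K + 1) *
      ((∑ p ∈ (Finset.univ : Finset S) ×ˢ Finset.range (K + 1), F p) * (a * b)) :=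
    mul_le_mul_of_nonneg_left h4 (by positivity)
  refine (add_le_add h5 (h3.trans h7)).trans (le_of_eq ?_)
  ring

section

/-! ### The moments of a rotated tuple as a functional on polynomials -/

variable {ι κ : Type*} {N : ℕ}

theorem continuous_lift_rotatedTuple (A : ι → Matrix (Fin N) (Fin N) ℂ)
    (B : κ → Matrix (Fin N) (Fin N) ℂ) (P : FreeAlgebra ℂ (ι ⊕ κ)) :
    Continuous fun U => FreeAlgebra.lift ℂ (rotatedTuple A B U) P := by
  induction P using FreeAlgebra.induction with
  | grade0 r => simpa using continuous_const
  | grade1 z =>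
    simp only [FreeAlgebra.lift_ι_apply]
    rcases z with i | j
    · exact continuous_const
    · change Continuous fun U : Matrix.unitaryGroup (Fin N) ℂ =>
        (U : Matrix (Fin N) (Fin N) ℂ) * B j * star (U : Matrix (Fin N) (Fin N) ℂ)
      fun_prop
  | mul a b ha hb => simp only [map_mul]; exact ha.mul hb
  | add a b ha hb => simp only [map_add]; exact ha.add hb

theorem continuous_ncDist_rotatedTuple (A : ι → Matrix (Fin N) (Fin N) ℂ)
    (B : κ → Matrix (Fin N) (Fin N) ℂ) (P : FreeAlgebra ℂ (ι ⊕ κ)) :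
    Continuous fun U => ncDist (rotatedTuple A B U) P := by
  simp only [ncDist, normTrace, LinearMap.comp_apply, LinearMap.smul_apply,
    Matrix.traceLinearMap_apply, smul_eq_mul]
  exact continuous_const.mul (continuous_lift_rotatedTuple A B P).matrix_trace

/-- The expectation of the distribution of the rotated tuple. -/
def rotatedMoment (μ : Measure (Matrix.unitaryGroup (Fin N) ℂ)) [IsFiniteMeasure μ]
    (A : ι → Matrix (Fin N) (Fin N) ℂ) (B : κ → Matrix (Fin N) (Fin N) ℂ) :
    FreeAlgebra ℂ (ι ⊕ κ) →ₗ[ℂ] ℂ where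
  toFun P := ∫ U, ncDist (rotatedTuple A B U) P ∂μ
  map_add' P Q := by
    simp only [map_add]
    exact integral_add (integrable_unitary μ (continuous_ncDist_rotatedTuple A B P))
      (integrable_unitary μ (continuous_ncDist_rotatedTuple A B Q))
  map_smul' c P := by
    simp only [map_smul, smul_eq_mul, RingHom.id_apply]
    exact integral_const_mul _ _

theorem lift_rotatedTuple_inX (A : ι → Matrix (Fin N) (Fin N) ℂ)
    (B : κ → Matrix (Fin N) (Fin N) ℂ) (U : Matrix.unitaryGroup (Fin N) ℂ)
    (P : FreeAlgebra ℂ ι) :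
    FreeAlgebra.lift ℂ (rotatedTuple A B U) (inX P) = FreeAlgebra.lift ℂ A P := by
  have : (FreeAlgebra.lift ℂ (rotatedTuple A B U)).comp inX = FreeAlgebra.lift ℂ A := by
    ext i
    simp [inX, rotatedTuple]
  exact DFunLike.congr_fun this P

theorem lift_rotatedTuple_inY (A : ι → Matrix (Fin N) (Fin N) ℂ)
    (B : κ → Matrix (Fin N) (Fin N) ℂ) (U : Matrix.unitaryGroup (Fin N) ℂ)
    (Q : FreeAlgebra ℂ κ) :
    FreeAlgebra.lift ℂ (rotatedTuple A B U) (inY Q) = (U : Matrix (Fin N) (Fin N) ℂ) *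
      FreeAlgebra.lift ℂ B Q * star (U : Matrix (Fin N) (Fin N) ℂ) := by
  have : (FreeAlgebra.lift ℂ (rotatedTuple A B U)).comp inY =
      ((Unitary.conjStarAlgAut ℂ (Matrix (Fin N) (Fin N) ℂ) U).toAlgEquiv : _ →ₐ[ℂ] _).comp
        (FreeAlgebra.lift ℂ B) := by
    ext1
    ext1 j
    simp [inY, rotatedTuple, Unitary.conjStarAlgAut_apply]
  exact DFunLike.congr_fun this Q

theorem rotatedMoment_alternatingProd {n : ℕ} (μ : Measure (Matrix.unitaryGroup (Fin N) ℂ))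
    [IsFiniteMeasure μ] (A : ι → Matrix (Fin N) (Fin N) ℂ) (B : κ → Matrix (Fin N) (Fin N) ℂ)
    (P : Fin n → FreeAlgebra ℂ ι) (Q : Fin n → FreeAlgebra ℂ κ) :
    rotatedMoment μ A B (alternatingProd P Q) =
      mixedMoment μ (fun s => FreeAlgebra.lift ℂ A (P s))
        (fun s => FreeAlgebra.lift ℂ B (Q s)) := by
  refine integral_congr_ae (Filter.Eventually.of_forall fun U => ?_)
  simp only [ncDist, LinearMap.comp_apply, AlgHom.toLinearMap_apply, alternatingProd]
  rw [map_list_prod, List.map_ofFn]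
  congr 3
  ext s : 1
  simp only [Function.comp_apply, map_mul, lift_rotatedTuple_inX, lift_rotatedTuple_inY]

/-! ### Amplification -/

/-- The amplification of a matrix to `m` diagonal blocks. -/
def amplify (N m : ℕ) : Matrix (Fin N) (Fin N) ℂ →ₐ[ℂ] Matrix (Fin (N * m)) (Fin (N * m)) ℂ :=
  ((Matrix.reindexAlgEquiv ℂ ℂ finProdFinEquiv).toAlgHom).comp
    { toFun := fun M => Matrix.blockDiagonal fun _ : Fin m => M
      map_one' := Matrix.blockDiagonal_one
      map_mul' := fun M M' => Matrix.blockDiagonal_mul (fun _ => M) fun _ => M'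
      map_zero' := Matrix.blockDiagonal_zero
      map_add' := fun M M' => Matrix.blockDiagonal_add (fun _ => M) fun _ => M'
      commutes' := fun r => by
        rw [Algebra.algebraMap_eq_smul_one, Algebra.algebraMap_eq_smul_one]
        have := Matrix.blockDiagonal_smul r (fun _ : Fin m => (1 : Matrix (Fin N) (Fin N) ℂ))
        have h1 : Matrix.blockDiagonal (fun _ : Fin m => (1 : Matrix (Fin N) (Fin N) ℂ)) = 1 :=
          Matrix.blockDiagonal_one
        rw [h1] at this
        exact this }

theorem normTrace_amplify {m : ℕ} (hm : m ≠ 0) (M : Matrix (Fin N) (Fin N) ℂ) :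
    normTrace (amplify N m M) = normTrace M := by
  have hm' : (m : ℂ) ≠ 0 := by exact_mod_cast hm
  have h : (amplify N m M).trace = m * M.trace := by
    change (Matrix.reindex finProdFinEquiv finProdFinEquiv
      (Matrix.blockDiagonal fun _ : Fin m => M)).trace = _
    have h1 : (Matrix.reindex finProdFinEquiv finProdFinEquiv
        (Matrix.blockDiagonal fun _ : Fin m => M)).trace =
        (Matrix.blockDiagonal fun _ : Fin m => M).trace :=
      Fintype.sum_equiv finProdFinEquiv.symm _ _ fun _ => rfl
    rw [h1, Matrix.trace_blockDiagonal]
    simp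
  simp only [normTrace, LinearMap.smul_apply, Matrix.traceLinearMap_apply, h, smul_eq_mul]
  push_cast
  rw [mul_inv]
  field_simp

theorem permTrace_amplify {n m : ℕ} (hm : m ≠ 0) (σ : Equiv.Perm (Fin n))
    (M : Fin n → Matrix (Fin N) (Fin N) ℂ) :
    permTrace σ (fun s => amplify N m (M s)) = permTrace σ M := by
  refine Finset.prod_congr rfl fun i _ => ?_
  conv_rhs => rw [← normTrace_amplify hm, map_list_prod, List.map_map]
  rfl

theorem mixedCoeff_amplify {n m : ℕ} (hm : m ≠ 0) (g : ℕ)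
    (A B : Fin n → Matrix (Fin N) (Fin N) ℂ) :
    mixedCoeff g (fun s => amplify N m (A s)) (fun s => amplify N m (B s)) = mixedCoeff g A B := by
  simp only [mixedCoeff, cumulant, permTrace_amplify hm]

theorem lift_amplify {m : ℕ} (A : ι → Matrix (Fin N) (Fin N) ℂ) (P : FreeAlgebra ℂ ι) :
    FreeAlgebra.lift ℂ (fun i => amplify N m (A i)) P = amplify N m (FreeAlgebra.lift ℂ A P) := by
  have : FreeAlgebra.lift ℂ (fun i => amplify N m (A i)) =
      (amplify N m).comp (FreeAlgebra.lift ℂ A) := by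
    ext1
    ext1 i
    simp
  exact DFunLike.congr_fun this P

/-! ### Asymptotic expansions -/

/-- `f` has the asymptotic expansion `∑_g c_g x^g` along the sequence `x`. -/
def HasExpansion (x f c : ℕ → ℂ) : Prop :=
  ∀ K : ℕ, ∃ C : ℝ, ∀ m, ‖f m - ∑ g ∈ Finset.range (K + 1), x m ^ g * c g‖ ≤ C * ‖x m‖ ^ (K + 1)

theorem HasExpansion.add {x f c f' c' : ℕ → ℂ} (h : HasExpansion x f c)
    (h' : HasExpansion x f' c') :
    HasExpansion x (fun m => f m + f' m) (fun g => c g + c' g) := by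
  intro K
  obtain ⟨C, hC⟩ := h K
  obtain ⟨C', hC'⟩ := h' K
  refine ⟨C + C', fun m => ?_⟩
  simp only [mul_add, Finset.sum_add_distrib]
  rw [add_sub_add_comm, add_mul]
  exact (norm_add_le _ _).trans (add_le_add (hC m) (hC' m))

theorem HasExpansion.const_mul {x f c : ℕ → ℂ} (h : HasExpansion x f c) (r : ℂ) :
    HasExpansion x (fun m => r * f m) (fun g => r * c g) := by
  intro K
  obtain ⟨C, hC⟩ := h K
  refine ⟨‖r‖ * C, fun m => ?_⟩
  have : ∑ g ∈ Finset.range (K + 1), x m ^ g * (r * c g) =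
      r * ∑ g ∈ Finset.range (K + 1), x m ^ g * c g := by
    rw [Finset.mul_sum]
    exact Finset.sum_congr rfl fun g _ => by ring
  rw [this, ← mul_sub, norm_mul, mul_assoc]
  exact mul_le_mul_of_nonneg_left (hC m) (norm_nonneg _)

theorem HasExpansion.unique {x f c c' : ℕ → ℂ} (hx : Filter.Tendsto x Filter.atTop (nhds 0))
    (hx0 : ∀ m, x m ≠ 0) (h : HasExpansion x f c) (h' : HasExpansion x f c') : c = c' := by
  have hd := h.add (h'.const_mul (-1))
  ext g
  rw [← sub_eq_zero]
  induction g using Nat.strong_induction_on with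
  | _ g ih =>
    obtain ⟨C, hC⟩ := hd g
    have hle : ∀ m, ‖c g - c' g‖ ≤ C * ‖x m‖ := by
      intro m
      have h1 := hC m
      rw [Finset.sum_range_succ, Finset.sum_eq_zero, zero_add] at h1
      · have hpos : 0 < ‖x m‖ ^ g := pow_pos (norm_pos_iff.2 (hx0 m)) g
        rw [show f m + -1 * f m - x m ^ g * (c g + -1 * c' g) = -(x m ^ g * (c g - c' g)) by ring,
          norm_neg, norm_mul, norm_pow, pow_succ, mul_left_comm] at h1
        exact le_of_mul_le_mul_left h1 hpos
      · intro j hj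
        have := ih j (Finset.mem_range.1 hj)
        dsimp only
        rw [show c j + -1 * c' j = c j - c' j by ring, this, mul_zero]
    have hlim : Filter.Tendsto (fun m => C * ‖x m‖) Filter.atTop (nhds 0) := by
      simpa using hx.norm.const_mul C
    exact norm_le_zero_iff.1 (ge_of_tendsto' hlim hle)

/-! ### The coefficients of the expansion as functionals on polynomials -/

/-- The part of a letter that belongs to the first family. -/
def leftPart : ι ⊕ κ → FreeAlgebra ℂ ι := Sum.elim (FreeAlgebra.ι ℂ) fun _ => 1

/-- The part of a letter that belongs to the second family. -/
def rightPart : ι ⊕ κ → FreeAlgebra ℂ κ := Sum.elim (fun _ => 1) (FreeAlgebra.ι ℂ)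

/-- The left factors of a word, seen as an alternating product. -/
def leftFactors (w : List (ι ⊕ κ)) : Fin (w.length + 1) → FreeAlgebra ℂ ι :=
  Fin.cons 1 fun s => leftPart (w.get s)

/-- The right factors of a word, seen as an alternating product. -/
def rightFactors (w : List (ι ⊕ κ)) : Fin (w.length + 1) → FreeAlgebra ℂ κ :=
  Fin.cons 1 fun s => rightPart (w.get s)

theorem alternatingProd_factors (w : List (ι ⊕ κ)) :
    alternatingProd (leftFactors w) (rightFactors w) = (w.map (FreeAlgebra.ι ℂ)).prod := by
  rw [alternatingProd, List.ofFn_succ, List.prod_cons]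
  simp only [leftFactors, rightFactors, Fin.cons_zero, map_one, mul_one, one_mul, Fin.cons_succ]
  congr 1
  have : ∀ z : ι ⊕ κ, inX (leftPart z) * inY (rightPart z) = FreeAlgebra.ι ℂ z := by
    rintro (i | j) <;> simp [leftPart, rightPart, inX, inY]
  simp only [this]
  rw [show (fun s : Fin w.length => FreeAlgebra.ι ℂ (w.get s)) = FreeAlgebra.ι ℂ ∘ w.get from rfl,
    ← List.map_ofFn, List.ofFn_get]

theorem basisFreeMonoid_apply {X : Type*} (w : FreeMonoid X) :
    FreeAlgebra.basisFreeMonoid ℂ X w = (w.toList.map (FreeAlgebra.ι ℂ)).prod := by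
  have : FreeAlgebra.basisFreeMonoid ℂ X w =
      FreeAlgebra.equivMonoidAlgebraFreeMonoid.symm (MonoidAlgebra.single w 1) := by
    simp [FreeAlgebra.basisFreeMonoid]
  rw [this]
  change MonoidAlgebra.lift ℂ _ _ (FreeMonoid.lift (FreeAlgebra.ι ℂ)) (MonoidAlgebra.single w 1) = _
  rw [MonoidAlgebra.lift_single, one_smul, FreeMonoid.lift_apply]

/-- The functional that gives the coefficient of `N^{-2g}` in the expansion of the moments. -/
def coeffFunctional (g : ℕ) (A : ι → Matrix (Fin N) (Fin N) ℂ) (B : κ → Matrix (Fin N) (Fin N) ℂ) :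
    FreeAlgebra ℂ (ι ⊕ κ) →ₗ[ℂ] ℂ :=
  (FreeAlgebra.basisFreeMonoid ℂ (ι ⊕ κ)).constr ℂ fun w =>
    mixedCoeff g (fun s => FreeAlgebra.lift ℂ A (leftFactors w.toList s))
      (fun s => FreeAlgebra.lift ℂ B (rightFactors w.toList s))

/-- The Haar probability measure on the unitary group. -/
def haarUnitary (N : ℕ) : Measure (Matrix.unitaryGroup (Fin N) ℂ) :=
  Measure.haarMeasure ⊤

instance (N : ℕ) : (haarUnitary N).IsHaarMeasure := Measure.isHaarMeasure_haarMeasure _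

instance (N : ℕ) : IsProbabilityMeasure (haarUnitary N) := ⟨by
  have := Measure.haarMeasure_self (K₀ := (⊤ : TopologicalSpace.PositiveCompacts
    (Matrix.unitaryGroup (Fin N) ℂ)))
  simpa [haarUnitary] using this⟩

/-- The moments of the amplified tuples. -/
def amplifiedMoment (A : ι → Matrix (Fin N) (Fin N) ℂ) (B : κ → Matrix (Fin N) (Fin N) ℂ) (m : ℕ) :
    FreeAlgebra ℂ (ι ⊕ κ) →ₗ[ℂ] ℂ :=
  rotatedMoment (haarUnitary (N * (m + 1))) (fun i => amplify N (m + 1) (A i))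
    (fun j => amplify N (m + 1) (B j))

theorem hasExpansion_alternatingProd (hN : N ≠ 0) (A : ι → Matrix (Fin N) (Fin N) ℂ)
    (B : κ → Matrix (Fin N) (Fin N) ℂ) {n : ℕ} (hn : 0 < n) (P : Fin n → FreeAlgebra ℂ ι)
    (Q : Fin n → FreeAlgebra ℂ κ) :
    HasExpansion (fun m => (((N * (m + 1) : ℕ) : ℂ) ^ 2)⁻¹)
      (fun m => amplifiedMoment A B m (alternatingProd P Q))
      (fun g => mixedCoeff g (fun s => FreeAlgebra.lift ℂ A (P s))
        (fun s => FreeAlgebra.lift ℂ B (Q s))) := by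
  intro K
  obtain ⟨C, hC0, hC⟩ := mixedMoment_expansion n hn K
  let a := ∑ σ, ‖permTrace σ fun s => FreeAlgebra.lift ℂ A (P s)‖
  let b := ∑ σ, ‖permTrace σ fun s => FreeAlgebra.lift ℂ B (Q s)‖
  refine ⟨C * (a * b), fun m => ?_⟩
  have h1 := hC (N * (m + 1)) (by positivity) (haarUnitary _)
    (fun s => amplify N (m + 1) (FreeAlgebra.lift ℂ A (P s)))
    (fun s => amplify N (m + 1) (FreeAlgebra.lift ℂ B (Q s))) a b
    (fun σ => by
      rw [permTrace_amplify (Nat.succ_ne_zero m)]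
      exact Finset.single_le_sum
        (f := fun σ => ‖permTrace σ fun s => FreeAlgebra.lift ℂ A (P s)‖)
        (fun _ _ => norm_nonneg _) (Finset.mem_univ σ))
    (fun σ => by
      rw [permTrace_amplify (Nat.succ_ne_zero m)]
      exact Finset.single_le_sum
        (f := fun σ => ‖permTrace σ fun s => FreeAlgebra.lift ℂ B (Q s)‖)
        (fun _ _ => norm_nonneg _) (Finset.mem_univ σ))
  simp only [mixedCoeff_amplify (Nat.succ_ne_zero m)] at h1
  dsimp only [amplifiedMoment]
  rw [rotatedMoment_alternatingProd]
  simp only [lift_amplify]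
  refine h1.trans (le_of_eq (by ring))

theorem hasExpansion_coeffFunctional (hN : N ≠ 0) (A : ι → Matrix (Fin N) (Fin N) ℂ)
    (B : κ → Matrix (Fin N) (Fin N) ℂ) (P : FreeAlgebra ℂ (ι ⊕ κ)) :
    HasExpansion (fun m => (((N * (m + 1) : ℕ) : ℂ) ^ 2)⁻¹) (fun m => amplifiedMoment A B m P)
      (fun g => coeffFunctional g A B P) := by
  have hP : P ∈ Submodule.span ℂ (Set.range (FreeAlgebra.basisFreeMonoid ℂ (ι ⊕ κ))) := by
    rw [Module.Basis.span_eq]; trivial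
  induction hP using Submodule.span_induction with
  | mem x hx =>
    obtain ⟨w, rfl⟩ := hx
    simp only [coeffFunctional, Module.Basis.constr_basis]
    rw [basisFreeMonoid_apply, ← alternatingProd_factors]
    exact hasExpansion_alternatingProd hN A B (Nat.succ_pos _) _ _
  | zero => intro K; exact ⟨0, fun m => by simp⟩
  | add x y _ _ hx hy => simpa only [map_add] using hx.add hy
  | smul c x _ hx => simpa only [map_smul, smul_eq_mul] using hx.const_mul c

theorem tendsto_amplified (hN : N ≠ 0) :
    Filter.Tendsto (fun m : ℕ => (((N * (m + 1) : ℕ) : ℂ) ^ 2)⁻¹) Filter.atTop (nhds 0) := by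
  rw [tendsto_zero_iff_norm_tendsto_zero]
  have h : Filter.Tendsto (fun m : ℕ => 1 / ((m : ℝ) + 1)) Filter.atTop (nhds 0) :=
    tendsto_one_div_add_atTop_nhds_zero_nat
  refine squeeze_zero (fun _ => norm_nonneg _) (fun m => ?_) h
  rw [norm_inv, norm_pow, Complex.norm_natCast, one_div]
  refine inv_anti₀ (by positivity) ?_
  have h1 : (1 : ℝ) ≤ N := by exact_mod_cast Nat.one_le_iff_ne_zero.2 hN
  have h2 : (0 : ℝ) ≤ m := Nat.cast_nonneg m
  push_cast
  nlinarith [mul_le_mul h1 (le_refl ((m : ℝ) + 1)) (by positivity) (by positivity)]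

theorem coeffFunctional_alternatingProd (hN : N ≠ 0) (A : ι → Matrix (Fin N) (Fin N) ℂ)
    (B : κ → Matrix (Fin N) (Fin N) ℂ) {n : ℕ} (hn : 0 < n) (P : Fin n → FreeAlgebra ℂ ι)
    (Q : Fin n → FreeAlgebra ℂ κ) (g : ℕ) :
    coeffFunctional g A B (alternatingProd P Q) =
      mixedCoeff g (fun s => FreeAlgebra.lift ℂ A (P s)) (fun s => FreeAlgebra.lift ℂ B (Q s)) := by
  refine congrFun (HasExpansion.unique (tendsto_amplified hN) (fun m => ?_)
    (hasExpansion_coeffFunctional hN A B _) (hasExpansion_alternatingProd hN A B hn P Q)) g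
  have : ((N * (m + 1) : ℕ) : ℂ) ≠ 0 := by exact_mod_cast (by positivity)
  positivity

end

section

/-! ### The leading coefficient is the free product -/

variable {ι κ : Type*} {N : ℕ}

theorem normTrace_one (hN : N ≠ 0) : normTrace (1 : Matrix (Fin N) (Fin N) ℂ) = 1 := by
  have : (N : ℂ) ≠ 0 := by exact_mod_cast hN
  simp [normTrace, this]

theorem ncDist_one (hN : N ≠ 0) (A : ι → Matrix (Fin N) (Fin N) ℂ) : ncDist A 1 = 1 := by
  simp [ncDist, normTrace_one hN]

theorem permTrace_fin_one (hN : N ≠ 0) (σ : Equiv.Perm (Fin 1))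
    (M : Fin 1 → Matrix (Fin N) (Fin N) ℂ) : permTrace σ M = normTrace (M 0) := by
  have hN' : (N : ℂ) ≠ 0 := by exact_mod_cast hN
  rw [Subsingleton.elim σ (finRotate 1)]
  have h := trace_prod_ofFn one_pos M
  rw [trSum_eq hN, numCycles_finRotate le_rfl, pow_one] at h
  rw [← mul_right_inj' hN', ← h, ← trace_eq_normTrace hN]
  simp

theorem mixedCoeff_fin_one (hN : N ≠ 0) (g : ℕ) (A B : Fin 1 → Matrix (Fin N) (Fin N) ℂ) :
    mixedCoeff g A B = if g = 0 then normTrace (A 0) * normTrace (B 0) else 0 := by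
  have hd : ∀ α β : Equiv.Perm (Fin 1), defect α β = 0 := fun α β => by
    rw [Subsingleton.elim α β, defect_self]
  have h := sum_cumulant g (1 : Equiv.Perm (Fin 1)) A
  rw [Finset.sum_eq_single_of_mem g (by simp)] at h
  · simp only [hd, add_zero, Finset.filter_true] at h
    rw [mixedCoeff]
    simp only [hd, zero_le, Finset.filter_true, Nat.zero_div, Nat.sub_zero, permTrace_fin_one hN,
      ← Finset.sum_mul]
    rw [h, permTrace_fin_one hN, ite_mul, zero_mul]
  · intro b _ hb
    refine Finset.sum_eq_zero fun β hβ => ?_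
    rw [Finset.mem_filter, hd] at hβ
    omega

theorem coeffFunctional_inX (hN : N ≠ 0) (A : ι → Matrix (Fin N) (Fin N) ℂ)
    (B : κ → Matrix (Fin N) (Fin N) ℂ) (g : ℕ) (P : FreeAlgebra ℂ ι) :
    coeffFunctional g A B (inX P) = if g = 0 then ncDist A P else 0 := by
  have h : (inX P : FreeAlgebra ℂ (ι ⊕ κ)) = alternatingProd (fun _ : Fin 1 => P) fun _ => 1 := by
    simp [alternatingProd]
  rw [h, coeffFunctional_alternatingProd hN A B one_pos, mixedCoeff_fin_one hN]
  simp [normTrace_one hN, ncDist]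

theorem coeffFunctional_inY (hN : N ≠ 0) (A : ι → Matrix (Fin N) (Fin N) ℂ)
    (B : κ → Matrix (Fin N) (Fin N) ℂ) (g : ℕ) (Q : FreeAlgebra ℂ κ) :
    coeffFunctional g A B (inY Q) = if g = 0 then ncDist B Q else 0 := by
  have h : (inY Q : FreeAlgebra ℂ (ι ⊕ κ)) = alternatingProd (fun _ : Fin 1 => 1) fun _ => Q := by
    simp [alternatingProd]
  rw [h, coeffFunctional_alternatingProd hN A B one_pos, mixedCoeff_fin_one hN]
  simp [normTrace_one hN, ncDist]

theorem permTrace_eq_zero_of_fixed {n : ℕ} {σ : Equiv.Perm (Fin n)} {s : Fin n} (hs : σ s = s)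
    {M : Fin n → Matrix (Fin N) (Fin N) ℂ} (hM : normTrace (M s) = 0) : permTrace σ M = 0 := by
  refine Finset.prod_eq_zero (i := s) ?_ ?_
  · simp only [Finset.mem_filter, Finset.mem_univ, true_and]
    intro j hj
    exact le_of_eq (hj.eq_of_left hs)
  · have : Function.minimalPeriod σ s = 1 := Function.minimalPeriod_eq_one_iff_isFixedPt.2 hs
    rw [this]
    simpa using hM

theorem cumulant_zero_eq_zero_of_fixed {n : ℕ} {M : Fin n → Matrix (Fin N) (Fin N) ℂ} {s : Fin n}
    (hM : normTrace (M s) = 0) (σ : Equiv.Perm (Fin n)) (hs : σ s = s) : cumulant 0 σ M = 0 := by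
  induction hk : permLength σ using Nat.strong_induction_on generalizing σ with
  | _ k ih =>
    have h := sum_cumulant 0 σ M
    rw [if_pos rfl, permTrace_eq_zero_of_fixed hs hM, zero_add, Finset.range_one,
      Finset.sum_singleton, Finset.sum_eq_single_of_mem σ (by simp [defect_self])] at h
    · exact h
    · intro β hβ hne
      have hd : defect β σ = 0 := by simpa using hβ
      have hlt : permLength β < k := by
        by_contra hle
        exact hne (eq_of_defect_eq_zero hd (by omega))
      exact ih _ hlt β (fixed_of_defect_eq_zero hd hs) rfl

theorem mixedCoeff_zero_eq_zero {n : ℕ} {A B : Fin (n + 1) → Matrix (Fin N) (Fin N) ℂ}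
    (hA : ∀ s, s ≠ 0 → normTrace (A s) = 0) (hB : ∀ s, s ≠ Fin.last n → normTrace (B s) = 0)
    (h : n = 0 → normTrace (A 0) = 0 ∨ normTrace (B (Fin.last n)) = 0) :
    mixedCoeff 0 A B = 0 := by
  refine Finset.sum_eq_zero fun α hα => ?_
  have hd : defect α (finRotate (n + 1)) = 0 := by simpa using hα
  by_cases h1 : ∃ s, α s = s ∧ normTrace (A s) = 0
  · obtain ⟨s, hs, hs0⟩ := h1
    rw [hd, Nat.zero_div, cumulant_zero_eq_zero_of_fixed hs0 α hs, zero_mul]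
  by_cases h2 : ∃ s, (α⁻¹ * finRotate (n + 1)) s = s ∧ normTrace (B s) = 0
  · obtain ⟨s, hs, hs0⟩ := h2
    rw [permTrace_eq_zero_of_fixed hs hs0, mul_zero]
  exfalso
  push Not at h1 h2
  have h3 := two_le_card_fixed (n := n + 1) (Nat.le_add_left 1 n) hd
  have hc1 : (Finset.univ.filter fun i => α i = i) ⊆ {0} := by
    intro i hi
    by_contra hne
    exact h1 i (by simpa using hi) (hA i (by simpa using hne))
  have hc2 : (Finset.univ.filter fun i => (α⁻¹ * finRotate (n + 1)) i = i) ⊆ {Fin.last n} := by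
    intro i hi
    by_contra hne
    exact h2 i (Finset.mem_filter.1 hi).2 (hB i (by simpa using hne))
  have hl1 := Finset.card_le_card hc1
  have hl2 := Finset.card_le_card hc2
  rw [Finset.card_singleton] at hl1 hl2
  have he1 := Finset.eq_of_subset_of_card_le hc1 (by rw [Finset.card_singleton]; omega)
  have he2 := Finset.eq_of_subset_of_card_le hc2 (by rw [Finset.card_singleton]; omega)
  have hf1 : α 0 = 0 := by
    have : (0 : Fin (n + 1)) ∈ Finset.univ.filter fun i => α i = i := by rw [he1]; simp
    simpa using this
  have hf2 : (α⁻¹ * finRotate (n + 1)) (Fin.last n) = Fin.last n := by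
    have : Fin.last n ∈ Finset.univ.filter fun i => (α⁻¹ * finRotate (n + 1)) i = i := by
      rw [he2]; simp
    exact (Finset.mem_filter.1 this).2
  have hf3 : α (Fin.last n) = 0 := by
    rw [Equiv.Perm.mul_apply, finRotate_last, Equiv.Perm.inv_eq_iff_eq] at hf2
    exact hf2.symm
  have hlast : Fin.last n = 0 := α.injective (hf3.trans hf1.symm)
  have hn : n = 0 := by simpa using congrArg Fin.val hlast
  rcases h hn with h | h
  · exact h1 0 hf1 h
  · exact h2 _ hf2 h

theorem exists_alternating_factors {τ₁ : FreeAlgebra ℂ ι →ₗ[ℂ] ℂ} {τ₂ : FreeAlgebra ℂ κ →ₗ[ℂ] ℂ}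
    {φ : FreeAlgebra ℂ (ι ⊕ κ) →ₗ[ℂ] ℂ} (h₁ : ∀ P, φ (inX P) = τ₁ P) (h₂ : ∀ Q, φ (inY Q) = τ₂ Q)
    (n : ℕ) (c : Fin (n + 1) → Bool) (a : Fin (n + 1) → FreeAlgebra ℂ (ι ⊕ κ))
    (hc : ∀ j : Fin n, c j.castSucc ≠ c j.succ)
    (ha : ∀ j, a j ∈ if c j then (inX : FreeAlgebra ℂ ι →ₐ[ℂ] FreeAlgebra ℂ (ι ⊕ κ)).range
      else (inY : FreeAlgebra ℂ κ →ₐ[ℂ] FreeAlgebra ℂ (ι ⊕ κ)).range)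
    (h0 : ∀ j, φ (a j) = 0) :
    ∃ (p : FreeAlgebra ℂ ι × FreeAlgebra ℂ κ) (R : List (FreeAlgebra ℂ ι × FreeAlgebra ℂ κ)),
      (List.ofFn a).prod = ((p :: R).map fun q => inX q.1 * inY q.2).prod ∧
      (∀ q ∈ R, τ₁ q.1 = 0) ∧ (∀ q ∈ (p :: R).dropLast, τ₂ q.2 = 0) ∧
      (c 0 = true → τ₁ p.1 = 0) ∧ (c 0 = false → p.1 = 1 ∧ (R = [] → τ₂ p.2 = 0)) := by
  induction n with
  | zero =>
    have ha0 := ha 0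
    have h00 := h0 0
    cases h : c 0
    · rw [h] at ha0
      obtain ⟨y, hy⟩ := ha0
      refine ⟨(1, y), [], ?_, by simp, by simp, by simp, fun _ => ⟨rfl, fun _ => ?_⟩⟩
      · simp [← hy]
      · rw [← h₂, ← h00, ← hy]; rfl
    · rw [h] at ha0
      obtain ⟨x, hx⟩ := ha0
      refine ⟨(x, 1), [], ?_, by simp, by simp, fun _ => ?_, by simp⟩
      · simp [← hx]
      · rw [← h₁, ← h00, ← hx]; rfl
  | succ n ih =>
    obtain ⟨p, R, hprod, hR, hdrop, htrue, hfalse⟩ := ih (fun j => c j.succ) (fun j => a j.succ)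
      (fun j => hc j.succ) (fun j => ha j.succ) (fun j => h0 j.succ)
    have hc0 := hc 0
    have ha0 := ha 0
    have h00 := h0 0
    rw [List.ofFn_succ, List.prod_cons, hprod]
    cases h : c 0
    · rw [h] at ha0
      obtain ⟨y, hy⟩ := ha0
      have h1 : c (Fin.succ 0) = true := by
        rw [Fin.castSucc_zero, h] at hc0
        cases h' : c (Fin.succ 0)
        · exact absurd h'.symm hc0
        · rfl
      have hy' : inY y = a 0 := hy
      refine ⟨(1, y), p :: R, by simp [hy'], ?_, ?_, by simp, fun _ => ⟨rfl, by simp⟩⟩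
      · intro q hq
        rcases List.mem_cons.1 hq with rfl | hq
        · exact htrue h1
        · exact hR q hq
      · intro q hq
        rw [List.dropLast_cons_cons] at hq
        rcases List.mem_cons.1 hq with rfl | hq
        · rw [← h₂, ← h00, ← hy']
        · exact hdrop q hq
    · rw [h] at ha0
      obtain ⟨x, hx⟩ := ha0
      have h1 : c (Fin.succ 0) = false := by
        rw [Fin.castSucc_zero, h] at hc0
        cases h' : c (Fin.succ 0)
        · rfl
        · exact absurd h'.symm hc0
      have hx' : inX x = a 0 := hx
      have hp := (hfalse h1).1
      refine ⟨(x, p.2), R, by simp [hx', hp, mul_assoc], hR, ?_, fun _ => ?_, by simp⟩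
      · intro q hq
        cases R with
        | nil => simp at hq
        | cons r R =>
          rw [List.dropLast_cons_cons] at hq hdrop
          rcases List.mem_cons.1 hq with rfl | hq
          · exact hdrop p (List.mem_cons_self ..)
          · exact hdrop q (List.mem_cons_of_mem _ hq)
      · rw [← h₁, ← h00, ← hx']

/-- The leading coefficient of the expansion of the moments is a free product. -/
theorem isFreeProduct_coeffFunctional (hN : N ≠ 0) (A : ι → Matrix (Fin N) (Fin N) ℂ)
    (B : κ → Matrix (Fin N) (Fin N) ℂ) :
    IsFreeProduct (ncDist A) (ncDist B) (coeffFunctional 0 A B) := by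
  have h₁ : ∀ P, coeffFunctional 0 A B (inX P) = ncDist A P := fun P => by
    rw [coeffFunctional_inX hN, if_pos rfl]
  have h₂ : ∀ Q, coeffFunctional 0 A B (inY Q) = ncDist B Q := fun Q => by
    rw [coeffFunctional_inY hN, if_pos rfl]
  refine ⟨h₁, h₂, fun n c a hc ha h0 => ?_⟩
  obtain ⟨p, R, hprod, hR, hdrop, htrue, hfalse⟩ := exists_alternating_factors h₁ h₂ n c a hc ha h0
  have halt : (List.ofFn a).prod = alternatingProd (fun s => ((p :: R).get s).1)
      fun s => ((p :: R).get s).2 := by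
    rw [hprod, alternatingProd]
    congr 1
    conv_lhs => rw [← List.ofFn_get (p :: R), List.map_ofFn]
    rfl
  rw [halt, coeffFunctional_alternatingProd hN A B (Nat.succ_pos _)]
  refine mixedCoeff_zero_eq_zero (n := R.length) (fun s hs => ?_) (fun s hs => ?_) fun hn => ?_
  · obtain ⟨j, rfl⟩ := Fin.exists_succ_eq.2 hs
    exact hR _ (List.get_mem R j)
  · have hlt : (s : ℕ) < (p :: R).dropLast.length := by
      rw [List.length_dropLast, List.length_cons]
      exact Fin.val_lt_last hs
    have := hdrop _ (List.getElem_mem hlt)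
    rw [List.getElem_dropLast] at this
    exact this
  · have hRnil : R = [] := List.length_eq_zero_iff.1 hn
    subst hRnil
    cases h : c 0
    · exact Or.inr ((hfalse h).2 rfl)
    · exact Or.inl (htrue h)

/-- Two free products of the same functionals agree on products of elements of the factors. -/
theorem IsFreeProduct.apply_prod_eq {τ₁ : FreeAlgebra ℂ ι →ₗ[ℂ] ℂ} {τ₂ : FreeAlgebra ℂ κ →ₗ[ℂ] ℂ}
    {φ ψ : FreeAlgebra ℂ (ι ⊕ κ) →ₗ[ℂ] ℂ} (hφ : IsFreeProduct τ₁ τ₂ φ) (hψ : IsFreeProduct τ₁ τ₂ ψ)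
    (h₁ : τ₁ 1 = 1) (L : List (Bool × FreeAlgebra ℂ (ι ⊕ κ)))
    (hL : ∀ x ∈ L, x.2 ∈ if x.1 then (inX : FreeAlgebra ℂ ι →ₐ[ℂ] FreeAlgebra ℂ (ι ⊕ κ)).range
      else (inY : FreeAlgebra ℂ κ →ₐ[ℂ] FreeAlgebra ℂ (ι ⊕ κ)).range) :
    φ (L.map Prod.snd).prod = ψ (L.map Prod.snd).prod := by
  have hφ1 : φ 1 = 1 := by rw [← map_one inX, hφ.1, h₁]
  have hψ1 : ψ 1 = 1 := by rw [← map_one inX, hψ.1, h₁]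
  let mem : Bool × FreeAlgebra ℂ (ι ⊕ κ) → Prop := fun x => x.2 ∈
    if x.1 then (inX : FreeAlgebra ℂ ι →ₐ[ℂ] FreeAlgebra ℂ (ι ⊕ κ)).range
      else (inY : FreeAlgebra ℂ κ →ₐ[ℂ] FreeAlgebra ℂ (ι ⊕ κ)).range
  have hmem : ∀ x, mem x → φ x.2 = ψ x.2 := by
    rintro ⟨b, x⟩ hx
    cases b
    · obtain ⟨y, rfl⟩ := hx
      exact (hφ.2.1 y).trans (hψ.2.1 y).symm
    · obtain ⟨y, rfl⟩ := hx
      exact (hφ.1 y).trans (hψ.1 y).symm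
  let center : Bool × FreeAlgebra ℂ (ι ⊕ κ) → Bool × FreeAlgebra ℂ (ι ⊕ κ) :=
    fun x => (x.1, x.2 - algebraMap ℂ _ (φ x.2))
  have hcenter : ∀ x, mem x → mem (center x) := fun x hx =>
    Subalgebra.sub_mem _ hx (Subalgebra.algebraMap_mem _ _)
  have hcenterφ : ∀ x, φ (center x).2 = 0 := fun x => by
    simp only [center, map_sub, Algebra.algebraMap_eq_smul_one, map_smul, hφ1, smul_eq_mul, mul_one,
      sub_self]
  induction hk : L.length using Nat.strong_induction_on generalizing L with
  | _ k ih =>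
    subst hk
    by_cases hchain : (L.map Prod.fst).IsChain (· ≠ ·)
    · have hrepl : ∀ L' M : List (Bool × FreeAlgebra ℂ (ι ⊕ κ)), (∀ x ∈ M, mem x) →
          (∀ x ∈ L', mem x) → M.length + L'.length = L.length →
          φ ((M ++ L').map Prod.snd).prod - ψ ((M ++ L').map Prod.snd).prod =
          φ ((M ++ L'.map center).map Prod.snd).prod -
            ψ ((M ++ L'.map center).map Prod.snd).prod := by
        intro L'
        induction L' with
        | nil => intro M _ _ _; simp
        | cons x L' ihL =>
          intro M hM hL' hlen
          have hx := hL' x (List.mem_cons_self ..)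
          have h1 := ihL (M ++ [center x]) (by
              intro y hy
              rcases List.mem_append.1 hy with hy | hy
              · exact hM y hy
              · rw [List.mem_singleton.1 hy]; exact hcenter x hx)
            (fun y hy => hL' y (List.mem_cons_of_mem _ hy))
            (by simp only [List.length_append, List.length_cons, List.length_nil] at hlen ⊢; omega)
          have h2 := ih (M ++ L').length
            (by simp only [List.length_append, List.length_cons] at hlen ⊢; omega) (M ++ L')
            (fun y hy => (List.mem_append.1 hy).elim (hM y)
              fun hy => hL' y (List.mem_cons_of_mem _ hy)) rfl
          rw [List.map_cons]
          rw [show M ++ center x :: L'.map center = M ++ [center x] ++ L'.map center by simp, ← h1]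
          have h3 : ((M ++ x :: L').map Prod.snd).prod =
              ((M ++ [center x] ++ L').map Prod.snd).prod +
                φ x.2 • ((M ++ L').map Prod.snd).prod := by
            simp only [List.map_append, List.map_cons, List.map_nil, List.prod_append,
              List.prod_cons, List.prod_nil, center, mul_one, Algebra.algebraMap_eq_smul_one]
            simp only [mul_sub, sub_mul, mul_smul_comm, smul_mul_assoc, mul_one, mul_assoc,
              sub_add_cancel]
          rw [h3, map_add, map_add, map_smul, map_smul, h2]
          ring
      have h1 := hrepl L [] (by simp) hL (by simp)
      simp only [List.nil_append] at h1
      rw [← sub_eq_zero, h1]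
      rcases L with _ | ⟨x, L⟩
      · simp [hφ1, hψ1]
      have hofFn : (((x :: L).map center).map Prod.snd) =
          List.ofFn fun j : Fin (L.length + 1) => (center ((x :: L).get j)).2 := by
        rw [List.map_map]
        conv_lhs => rw [← List.ofFn_get (x :: L), List.map_ofFn]
        rfl
      have hne : ∀ j : Fin L.length, ((x :: L).get j.castSucc).1 ≠ ((x :: L).get j.succ).1 := by
        intro j
        have := List.isChain_iff_getElem.1 hchain j (by simp)
        rw [List.getElem_map, List.getElem_map] at this
        exact this
      have hmem' : ∀ j : Fin (L.length + 1), mem (center ((x :: L).get j)) := fun j =>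
        hcenter _ (hL _ (List.get_mem _ _))
      rw [hofFn, hφ.2.2 L.length (fun j => ((x :: L).get j).1) _ hne hmem' fun j => hcenterφ _,
        hψ.2.2 L.length (fun j => ((x :: L).get j).1) _ hne hmem' fun j => by
          rw [← hmem _ (hmem' j)]; exact hcenterφ _, sub_self]
    · obtain ⟨L₁, x, y, L₂, rfl, hxy⟩ : ∃ L₁ x y L₂, L = L₁ ++ x :: y :: L₂ ∧ x.1 = y.1 := by
        rw [List.isChain_iff_getElem] at hchain
        push Not at hchain
        obtain ⟨i, hi, heq⟩ := hchain
        rw [List.length_map] at hi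
        refine ⟨L.take i, L[i], L[i + 1], L.drop (i + 2), ?_, by simpa using heq⟩
        rw [List.getElem_cons_drop, List.getElem_cons_drop, List.take_append_drop]
      have h1 := ih (L₁ ++ (x.1, x.2 * y.2) :: L₂).length (by simp)
        (L₁ ++ (x.1, x.2 * y.2) :: L₂) (by
          intro z hz
          rcases List.mem_append.1 hz with hz | hz
          · exact hL z (List.mem_append_left _ hz)
          rcases List.mem_cons.1 hz with rfl | hz
          · have hx := hL x (by simp)
            have hy := hL y (by simp)
            rw [← hxy] at hy
            exact Subalgebra.mul_mem _ hx hy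
          · exact hL z (by simp [hz])) rfl
      simpa [mul_assoc] using h1

theorem IsFreeProduct.unique {τ₁ : FreeAlgebra ℂ ι →ₗ[ℂ] ℂ} {τ₂ : FreeAlgebra ℂ κ →ₗ[ℂ] ℂ}
    {φ ψ : FreeAlgebra ℂ (ι ⊕ κ) →ₗ[ℂ] ℂ} (hφ : IsFreeProduct τ₁ τ₂ φ) (hψ : IsFreeProduct τ₁ τ₂ ψ)
    (h₁ : τ₁ 1 = 1) : φ = ψ := by
  refine (FreeAlgebra.basisFreeMonoid ℂ (ι ⊕ κ)).ext fun w => ?_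
  rw [basisFreeMonoid_apply]
  have h := hφ.apply_prod_eq hψ h₁ (w.toList.map fun z => (z.isLeft, FreeAlgebra.ι ℂ z)) ?_
  · simpa [Function.comp_def] using h
  · intro x hx
    obtain ⟨z, -, rfl⟩ := List.mem_map.1 hx
    rcases z with i | j
    · exact ⟨FreeAlgebra.ι ℂ i, by simp [inX]⟩
    · exact ⟨FreeAlgebra.ι ℂ j, by simp [inY]⟩

end

section

/-! ### Traces of tuples padded with identity matrices -/

variable {N : ℕ}

/-- The normalized trace of a tuple along a permutation of an arbitrary index type. -/
def normTrSum {ι : Type*} [Fintype ι] [DecidableEq ι] (σ : Equiv.Perm ι)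
    (M : ι → Matrix (Fin N) (Fin N) ℂ) : ℂ :=
  trSum σ M / trSum σ fun _ => (1 : Matrix (Fin N) (Fin N) ℂ)

theorem normTrSum_eq_permTrace {n : ℕ} (hN : N ≠ 0) (σ : Equiv.Perm (Fin n))
    (M : Fin n → Matrix (Fin N) (Fin N) ℂ) : normTrSum σ M = permTrace σ M := by
  have : (N : ℂ) ^ numCycles σ ≠ 0 := pow_ne_zero _ (by exact_mod_cast hN)
  rw [normTrSum, trSum_eq hN, trSum_eq hN, permTrace_one hN, mul_one, mul_div_cancel_left₀ _ this]

theorem normTrSum_equiv {ι κ : Type*} [Fintype ι] [DecidableEq ι] [Fintype κ] [DecidableEq κ]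
    (e : κ ≃ ι) (σ : Equiv.Perm ι) (M : ι → Matrix (Fin N) (Fin N) ℂ) :
    normTrSum σ M = normTrSum ((e.trans σ).trans e.symm) fun x => M (e x) := by
  rw [normTrSum, normTrSum, trSum_equiv e σ ((e.trans σ).trans e.symm) (by simp) M,
    trSum_equiv e σ ((e.trans σ).trans e.symm) (by simp) fun _ => 1]

theorem trSum_removeNone {ι : Type*} [Fintype ι] [DecidableEq ι] (σ : Equiv.Perm (Option ι))
    (M : Option ι → Matrix (Fin N) (Fin N) ℂ) (hM : M none = 1) :
    trSum σ M = (if σ none = none then (N : ℂ) else 1) *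
      trSum (Equiv.removeNone σ) fun s => M (some s) := by
  unfold trSum
  rw [← Equiv.sum_comp (Equiv.piOptionEquivProd (β := fun _ : Option ι => Fin N)).symm,
    Fintype.sum_prod_type, Finset.sum_comm, Finset.mul_sum]
  refine Finset.sum_congr rfl fun i _ => ?_
  simp only [Fintype.prod_option]
  let f : Fin N → Option ι → Fin N := fun v o => o.elim v i
  have hfn : ∀ v, f v none = v := fun v => rfl
  have hfs : ∀ v s, f v (some s) = i s := fun v s => rfl
  have hf : ∀ v, (Equiv.piOptionEquivProd (β := fun _ : Option ι => Fin N)).symm (v, i) = f v := by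
    intro v
    funext o
    cases o <;> rfl
  have hone : ∀ a b, M none a b = if a = b then 1 else 0 := fun a b => by rw [hM, Matrix.one_apply]
  simp only [hf, hfn, hfs, hone]
  by_cases h : σ none = none
  · have hsome : ∀ v s, f v (σ (some s)) = i (Equiv.removeNone σ s) := by
      intro v s
      have hex : ∃ s', σ (some s) = some s' := by
        rw [← Option.ne_none_iff_exists']
        intro h'
        exact Option.some_ne_none s (σ.injective (h'.trans h.symm))
      rw [← Equiv.removeNone_some σ hex, hfs]
    simp [h, hfn, hsome]
  · obtain ⟨t, ht⟩ := Option.ne_none_iff_exists'.1 h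
    rw [if_neg h, one_mul, Finset.sum_eq_single_of_mem (i t) (Finset.mem_univ _)]
    · rw [ht, hfs, if_pos rfl, one_mul]
      refine Finset.prod_congr rfl fun s _ => ?_
      by_cases hs : σ (some s) = none
      · have h1 := Equiv.removeNone_none σ hs
        rw [ht] at h1
        rw [hs, hfn, Option.some.inj h1]
      · rw [← Equiv.removeNone_some σ (Option.ne_none_iff_exists'.1 hs), hfs]
    · intro v _ hv
      rw [ht, hfs, if_neg hv, zero_mul]

theorem normTrSum_removeNone {ι : Type*} [Fintype ι] [DecidableEq ι] (hN : N ≠ 0)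
    (σ : Equiv.Perm (Option ι)) (M : Option ι → Matrix (Fin N) (Fin N) ℂ) (hM : M none = 1) :
    normTrSum σ M = normTrSum (Equiv.removeNone σ) fun s => M (some s) := by
  have h : (if σ none = none then (N : ℂ) else 1) ≠ 0 := by
    split_ifs
    · exact_mod_cast hN
    · exact one_ne_zero
  rw [normTrSum, trSum_removeNone σ M hM, trSum_removeNone σ (fun _ => 1) rfl,
    mul_div_mul_left _ _ h, normTrSum]

/-- Identity matrices can be removed from a normalized trace along a permutation. -/
theorem exists_normTrSum_eq {κ : Type*} (hN : N ≠ 0) (C : κ → Matrix (Fin N) (Fin N) ℂ) (m : ℕ) :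
    ∀ {ι : Type} [Fintype ι] [DecidableEq ι] (z : ι → Option κ) (σ : Equiv.Perm ι) (a : ℕ),
      Fintype.card ι = m → (∑ s, if (z s).isSome then 1 else 0) = a →
      ∃ (τ : Equiv.Perm (Fin a)) (x : Fin a → κ),
        normTrSum σ (fun s => (z s).elim 1 C) = normTrSum τ fun s => C (x s) := by
  induction m with
  | zero =>
    intro ι _ _ z σ a hcard ha
    have := Fintype.card_eq_zero_iff.1 hcard
    obtain rfl : a = 0 := by rw [← ha]; simp
    refine ⟨1, Fin.elim0, ?_⟩
    rw [normTrSum_equiv (Equiv.equivOfIsEmpty (Fin 0) ι)]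
    congr 1
    · exact Equiv.ext fun s => s.elim0
    · exact funext fun s => s.elim0
  | succ m ih =>
    intro ι _ _ z σ a hcard ha
    by_cases hall : ∀ s, (z s).isSome
    · have ha' : Fintype.card ι = a := by simpa [hall] using ha
      let e : Fin a ≃ ι := (Fintype.equivFinOfCardEq ha').symm
      refine ⟨(e.trans σ).trans e.symm, fun s => (z (e s)).get (hall _), ?_⟩
      rw [normTrSum_equiv e]
      congr 1
      ext s : 1
      conv_lhs => rw [← Option.some_get (hall (e s))]
      rfl
    · push Not at hall
      obtain ⟨s₀, hs₀⟩ := hall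
      have hz : z s₀ = none := by simpa using hs₀
      let e : Option {s // s ≠ s₀} ≃ ι := Equiv.optionSubtypeNe s₀
      have he : e none = s₀ := Equiv.optionSubtypeNe_none s₀
      have hes : ∀ s, e (some s) = s := fun s => Equiv.optionSubtypeNe_some s₀ s
      have hcard' : Fintype.card {s // s ≠ s₀} = m := by
        have := Fintype.card_congr e
        rw [Fintype.card_option] at this
        omega
      have ha' : (∑ s : {s // s ≠ s₀}, if (z s).isSome then 1 else 0) = a := by
        rw [← ha, ← Equiv.sum_comp e, Fintype.sum_option, he, hz]
        simp [hes]
      obtain ⟨τ, x, h⟩ := ih (fun s : {s // s ≠ s₀} => z s)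
        (Equiv.removeNone ((e.trans σ).trans e.symm)) a hcard' ha'
      refine ⟨τ, x, ?_⟩
      rw [← h, normTrSum_equiv e, normTrSum_removeNone hN _ _ (by rw [he, hz]; rfl)]
      simp only [hes]

/-! ### Bounds by the norms of the sequences -/

theorem permTrace_eq_prod_ncDist {k n : ℕ} (C : Fin k → Matrix (Fin N) (Fin N) ℂ)
    (σ : Equiv.Perm (Fin n)) (x : Fin n → Fin k) :
    permTrace σ (fun s => C (x s)) = ∏ i : Fin n with ∀ j, σ.SameCycle i j → i ≤ j,
      ncDist C ((List.range (Function.minimalPeriod σ i)).map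
        fun s => FreeAlgebra.ι ℂ (x ((σ ^ s) i))).prod := by
  refine Finset.prod_congr (by ext; simp) fun i _ => ?_
  simp only [ncDist, LinearMap.comp_apply, AlgHom.toLinearMap_apply]
  rw [map_list_prod (FreeAlgebra.lift ℂ C), List.map_map]
  congr 2
  refine List.map_congr_left fun s _ => ?_
  simp

theorem bddAbove_permTrace {k n : ℕ} {C : (N : ℕ+) → Fin k → Matrix (Fin N) (Fin N) ℂ}
    (hC : BoundedInDist C) :
      BddAbove (Set.range fun x : ℕ+ × Equiv.Perm (Fin n) × (Fin n → Fin k) =>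
      ‖permTrace x.2.1 fun s => C x.1 (x.2.2 s)‖) := by
  choose b hb using hC
  have hb' : ∀ P (N : ℕ+), ‖ncDist (C N) P‖ ≤ b P := fun P N => hb P ⟨N, rfl⟩
  have hb0 : ∀ P, 0 ≤ b P := fun P => (norm_nonneg _).trans (hb' P 1)
  let f : Equiv.Perm (Fin n) × (Fin n → Fin k) → ℝ := fun y =>
    ∏ i : Fin n with ∀ j, y.1.SameCycle i j → i ≤ j,
      b ((List.range (Function.minimalPeriod y.1 i)).map
        fun s => FreeAlgebra.ι ℂ (y.2 ((y.1 ^ s) i))).prod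
  have hf0 : ∀ y, 0 ≤ f y := fun y => Finset.prod_nonneg fun _ _ => hb0 _
  refine ⟨∑ y, f y, ?_⟩
  rintro _ ⟨⟨N, y⟩, rfl⟩
  refine le_trans ?_ (Finset.single_le_sum (fun y _ => hf0 y) (Finset.mem_univ y))
  dsimp only
  rw [permTrace_eq_prod_ncDist, norm_prod]
  exact Finset.prod_le_prod (fun _ _ => norm_nonneg _) fun _ _ => hb' _ _

theorem norm_permTrace_le_starNorm {k n : ℕ} {C : (N : ℕ+) → Fin k → Matrix (Fin N) (Fin N) ℂ}
    (hC : BoundedInDist C) (N : ℕ+) (σ : Equiv.Perm (Fin n)) (x : Fin n → Fin k) :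
    ‖permTrace σ fun s => C N (x s)‖ ≤ starNorm C n :=
  le_ciSup (bddAbove_permTrace hC) (N, σ, x)

theorem starNorm_nonneg {k : ℕ} (C : (N : ℕ+) → Fin k → Matrix (Fin N) (Fin N) ℂ) (n : ℕ) :
    0 ≤ starNorm C n := Real.iSup_nonneg fun _ => norm_nonneg _

theorem norm_permTrace_elim_le {k n : ℕ} {C : (N : ℕ+) → Fin k → Matrix (Fin N) (Fin N) ℂ}
    (hC : BoundedInDist C) (N : ℕ+) (z : Fin n → Option (Fin k)) (σ : Equiv.Perm (Fin n)) :
    ‖permTrace σ fun s => (z s).elim 1 (C N)‖ ≤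
      starNorm C (∑ s, if (z s).isSome then 1 else 0) := by
  have hN : (N : ℕ) ≠ 0 := N.ne_zero
  obtain ⟨τ, x, h⟩ := exists_normTrSum_eq hN (C N) _ z σ _ rfl rfl
  rw [normTrSum_eq_permTrace hN, normTrSum_eq_permTrace hN] at h
  rw [h]
  exact norm_permTrace_le_starNorm hC N τ x

/-- The number of letters of a word that belong to the first family. -/
def leftCount {ι κ : Type*} (w : List (ι ⊕ κ)) : ℕ :=
  (w.map fun z => if z.getLeft?.isSome then 1 else 0).sum

/-- The number of letters of a word that belong to the second family. -/
def rightCount {ι κ : Type*} (w : List (ι ⊕ κ)) : ℕ :=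
  (w.map fun z => if z.getRight?.isSome then 1 else 0).sum

theorem leftCount_add_rightCount {ι κ : Type*} (w : List (ι ⊕ κ)) :
    leftCount w + rightCount w = w.length := by
  induction w with
  | nil => rfl
  | cons z w ih =>
    rw [List.length_cons, ← ih]
    rcases z with i | j <;> simp [leftCount, rightCount] <;> omega

theorem exists_eq_inY {ι κ : Type*} {w : List (ι ⊕ κ)} (h : leftCount w = 0) :
    ∃ Q : FreeAlgebra ℂ κ, (w.map (FreeAlgebra.ι ℂ)).prod = inY Q := by
  induction w with
  | nil => exact ⟨1, by simp⟩
  | cons z w ih =>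
    rcases z with i | j
    · simp [leftCount] at h
    · obtain ⟨Q, hQ⟩ := ih (by simpa [leftCount] using h)
      exact ⟨FreeAlgebra.ι ℂ j * Q, by simp [hQ, inY]⟩

theorem exists_eq_inX {ι κ : Type*} {w : List (ι ⊕ κ)} (h : rightCount w = 0) :
    ∃ P : FreeAlgebra ℂ ι, (w.map (FreeAlgebra.ι ℂ)).prod = inX P := by
  induction w with
  | nil => exact ⟨1, by simp⟩
  | cons z w ih =>
    rcases z with i | j
    · obtain ⟨P, hP⟩ := ih (by simpa [rightCount] using h)
      exact ⟨FreeAlgebra.ι ℂ i * P, by simp [hP, inX]⟩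
    · simp [rightCount] at h

theorem sum_fin_cons_none {X κ : Type*} (w : List X) (f : X → Option κ) :
    (∑ s, if ((Fin.cons none fun s => f (w.get s) : Fin (w.length + 1) → Option κ) s).isSome
      then 1 else 0) = (w.map fun z => if (f z).isSome then 1 else 0).sum := by
  rw [Fin.sum_univ_succ]
  simp only [Fin.cons_zero, Fin.cons_succ]
  rw [← List.sum_ofFn, show (fun s : Fin w.length => if (f (w.get s)).isSome then 1 else 0) =
    (fun z => if (f z).isSome then 1 else 0) ∘ w.get from rfl, ← List.map_ofFn, List.ofFn_get]
  simp

theorem norm_permTrace_leftFactors_le {k l : ℕ}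
    {A : (N : ℕ+) → Fin k → Matrix (Fin N) (Fin N) ℂ} (hA : BoundedInDist A) (N : ℕ+)
    (w : List (Fin k ⊕ Fin l)) (σ : Equiv.Perm (Fin (w.length + 1))) :
    ‖permTrace σ fun s => FreeAlgebra.lift ℂ (A N) (leftFactors w s)‖ ≤
      starNorm A (leftCount w) := by
  have h := norm_permTrace_elim_le hA N (Fin.cons none fun s => (w.get s).getLeft?) σ
  rw [sum_fin_cons_none w Sum.getLeft?, ← leftCount] at h
  convert h using 2
  refine congrArg _ (funext fun s => ?_)
  refine Fin.cases ?_ (fun s => ?_) s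
  · simp [leftFactors]
  · simp only [leftFactors, Fin.cons_succ]
    rcases w.get s with i | j <;> simp [leftPart]

theorem norm_permTrace_rightFactors_le {k l : ℕ}
    {B : (N : ℕ+) → Fin l → Matrix (Fin N) (Fin N) ℂ} (hB : BoundedInDist B) (N : ℕ+)
    (w : List (Fin k ⊕ Fin l)) (σ : Equiv.Perm (Fin (w.length + 1))) :
    ‖permTrace σ fun s => FreeAlgebra.lift ℂ (B N) (rightFactors w s)‖ ≤
      starNorm B (rightCount w) := by
  have h := norm_permTrace_elim_le hB N (Fin.cons none fun s => (w.get s).getRight?) σ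
  rw [sum_fin_cons_none w Sum.getRight?, ← rightCount] at h
  convert h using 2
  refine congrArg _ (funext fun s => ?_)
  refine Fin.cases ?_ (fun s => ?_) s
  · simp [rightFactors]
  · simp only [rightFactors, Fin.cons_succ]
    rcases w.get s with i | j <;> simp [rightPart]

/-- The sum of products of norms in the bound of the remainder. -/
def normSum {k l : ℕ} (A : (N : ℕ+) → Fin k → Matrix (Fin N) (Fin N) ℂ)
    (B : (N : ℕ+) → Fin l → Matrix (Fin N) (Fin N) ℂ) (d : ℕ) : ℝ :=
  ∑ a ∈ Finset.Icc 1 d, ∑ b ∈ Finset.Icc 1 d with a + b ≤ d, starNorm A a * starNorm B b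

theorem normSum_nonneg {k l : ℕ} (A : (N : ℕ+) → Fin k → Matrix (Fin N) (Fin N) ℂ)
    (B : (N : ℕ+) → Fin l → Matrix (Fin N) (Fin N) ℂ) (d : ℕ) : 0 ≤ normSum A B d :=
  Finset.sum_nonneg fun _ _ => Finset.sum_nonneg fun _ _ =>
    mul_nonneg (starNorm_nonneg A _) (starNorm_nonneg B _)

theorem starNorm_mul_le_normSum {k l : ℕ} (A : (N : ℕ+) → Fin k → Matrix (Fin N) (Fin N) ℂ)
    (B : (N : ℕ+) → Fin l → Matrix (Fin N) (Fin N) ℂ) {a b d : ℕ} (ha : 1 ≤ a) (hb : 1 ≤ b)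
    (hd : a + b ≤ d) : starNorm A a * starNorm B b ≤ normSum A B d := by
  have hnn : ∀ a b, 0 ≤ starNorm A a * starNorm B b := fun a b =>
    mul_nonneg (starNorm_nonneg A _) (starNorm_nonneg B _)
  refine le_trans ?_ (Finset.single_le_sum (f := fun a =>
    ∑ b ∈ Finset.Icc 1 d with a + b ≤ d, starNorm A a * starNorm B b)
    (fun a _ => Finset.sum_nonneg fun b _ => hnn a b) (Finset.mem_Icc.2 ⟨ha, by omega⟩))
  exact Finset.single_le_sum (f := fun b => starNorm A a * starNorm B b) (fun b _ => hnn a b)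
    (Finset.mem_filter.2 ⟨Finset.mem_Icc.2 ⟨hb, by omega⟩, hd⟩)

theorem rotatedMoment_inX {ι κ : Type*} (μ : Measure (Matrix.unitaryGroup (Fin N) ℂ))
    [IsProbabilityMeasure μ] (A : ι → Matrix (Fin N) (Fin N) ℂ) (B : κ → Matrix (Fin N) (Fin N) ℂ)
    (P : FreeAlgebra ℂ ι) : rotatedMoment μ A B (inX P) = ncDist A P := by
  change ∫ U, ncDist (rotatedTuple A B U) (inX P) ∂μ = _
  simp [ncDist, lift_rotatedTuple_inX]

theorem rotatedMoment_inY {ι κ : Type*} (μ : Measure (Matrix.unitaryGroup (Fin N) ℂ))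
    [IsProbabilityMeasure μ] (A : ι → Matrix (Fin N) (Fin N) ℂ) (B : κ → Matrix (Fin N) (Fin N) ℂ)
    (Q : FreeAlgebra ℂ κ) : rotatedMoment μ A B (inY Q) = ncDist B Q := by
  change ∫ U, ncDist (rotatedTuple A B U) (inY Q) ∂μ = _
  have h : ∀ U : Matrix.unitaryGroup (Fin N) ℂ,
      ncDist (rotatedTuple A B U) (inY Q) = ncDist B Q := by
    intro U
    simp only [ncDist, LinearMap.comp_apply, AlgHom.toLinearMap_apply, lift_rotatedTuple_inY,
      normTrace, LinearMap.smul_apply, Matrix.traceLinearMap_apply]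
    rw [Matrix.trace_mul_comm, ← mul_assoc,
      show star (U : Matrix (Fin N) (Fin N) ℂ) * U = 1 by simp, one_mul]
  simp [h]

/-- The expansion of the moment of a word. -/
theorem exists_word_bound {k l : ℕ} (w : FreeMonoid (Fin k ⊕ Fin l)) (K : ℕ) : ∃ C : ℝ, 0 ≤ C ∧
    ∀ (A : (N : ℕ+) → Fin k → Matrix (Fin N) (Fin N) ℂ)
      (B : (N : ℕ+) → Fin l → Matrix (Fin N) (Fin N) ℂ), BoundedInDist A → BoundedInDist B →
    ∀ (N : ℕ+) (μ : Measure (Matrix.unitaryGroup (Fin N) ℂ)) [μ.IsHaarMeasure]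
      [IsProbabilityMeasure μ] (d : ℕ), w.length ≤ d →
    ‖rotatedMoment μ (A N) (B N) (FreeAlgebra.basisFreeMonoid ℂ _ w) -
      ∑ g ∈ Finset.range (K + 1), (((N : ℕ) : ℂ) ^ 2)⁻¹ ^ g *
        coeffFunctional g (A N) (B N) (FreeAlgebra.basisFreeMonoid ℂ _ w)‖ ≤
      C * ‖(((N : ℕ) : ℂ) ^ 2)⁻¹‖ ^ (K + 1) * normSum A B d := by
  obtain ⟨C, hC0, hC⟩ := mixedMoment_expansion (w.toList.length + 1) (Nat.succ_pos _) K
  refine ⟨C, hC0, fun A B hA hB N μ _ _ d hd => ?_⟩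
  have hN : (N : ℕ) ≠ 0 := N.ne_zero
  have hrhs : 0 ≤ C * ‖(((N : ℕ) : ℂ) ^ 2)⁻¹‖ ^ (K + 1) * normSum A B d :=
    mul_nonneg (by positivity) (normSum_nonneg A B d)
  have hd' : w.toList.length ≤ d := hd
  rw [basisFreeMonoid_apply]
  by_cases hl : leftCount w.toList = 0
  · obtain ⟨Q, hQ⟩ := exists_eq_inY hl
    rw [hQ, rotatedMoment_inY, Finset.sum_range_succ']
    simpa [coeffFunctional_inY hN] using hrhs
  by_cases hr : rightCount w.toList = 0
  · obtain ⟨P, hP⟩ := exists_eq_inX hr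
    rw [hP, rotatedMoment_inX, Finset.sum_range_succ']
    simpa [coeffFunctional_inX hN] using hrhs
  have hsum := leftCount_add_rightCount w.toList
  rw [← alternatingProd_factors, rotatedMoment_alternatingProd]
  simp only [coeffFunctional_alternatingProd hN _ _ (Nat.succ_pos _)]
  refine (hC N hN μ _ _ _ _ (norm_permTrace_leftFactors_le hA N w.toList)
    (norm_permTrace_rightFactors_le hB N w.toList)).trans ?_
  exact mul_le_mul_of_nonneg_left (starNorm_mul_le_normSum A B (Nat.one_le_iff_ne_zero.2 hl)
    (Nat.one_le_iff_ne_zero.2 hr) (by omega)) (by positivity)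

theorem length_le_ncDegree {ι : Type*} (P : FreeAlgebra ℂ ι) {w : FreeMonoid ι}
    (hw : w ∈ ((FreeAlgebra.basisFreeMonoid ℂ ι).repr P).support) : w.length ≤ ncDegree P :=
  Finset.le_sup (f := FreeMonoid.length) hw

/-- The expansion of the moment of a polynomial. -/
theorem exists_polynomial_bound {k l : ℕ} (P : FreeAlgebra ℂ (Fin k ⊕ Fin l)) (K : ℕ) : ∃ C : ℝ,
    ∀ (A : (N : ℕ+) → Fin k → Matrix (Fin N) (Fin N) ℂ)
      (B : (N : ℕ+) → Fin l → Matrix (Fin N) (Fin N) ℂ), BoundedInDist A → BoundedInDist B →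
    ∀ (N : ℕ+) (μ : Measure (Matrix.unitaryGroup (Fin N) ℂ)) [μ.IsHaarMeasure]
      [IsProbabilityMeasure μ],
    ‖rotatedMoment μ (A N) (B N) P - ∑ g ∈ Finset.range (K + 1), (((N : ℕ) : ℂ) ^ 2)⁻¹ ^ g *
        coeffFunctional g (A N) (B N) P‖ ≤
      C * ‖(((N : ℕ) : ℂ) ^ 2)⁻¹‖ ^ (K + 1) * normSum A B (ncDegree P) := by
  choose C hC0 hC using fun w : FreeMonoid (Fin k ⊕ Fin l) => exists_word_bound w K
  let b := FreeAlgebra.basisFreeMonoid ℂ (Fin k ⊕ Fin l)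
  refine ⟨∑ w ∈ (b.repr P).support, ‖b.repr P w‖ * C w, fun A B hA hB N μ _ _ => ?_⟩
  have hP : P = ∑ w ∈ (b.repr P).support, b.repr P w • b w := by
    conv_lhs => rw [← b.linearCombination_repr P]
    rfl
  have hφ : ∀ φ : FreeAlgebra ℂ (Fin k ⊕ Fin l) →ₗ[ℂ] ℂ,
      φ P = ∑ w ∈ (b.repr P).support, b.repr P w * φ (b w) := fun φ => by
    conv_lhs => rw [hP]
    simp only [map_sum, map_smul, smul_eq_mul]
  have hdiff : rotatedMoment μ (A N) (B N) P - ∑ g ∈ Finset.range (K + 1),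
      (((N : ℕ) : ℂ) ^ 2)⁻¹ ^ g * coeffFunctional g (A N) (B N) P =
      ∑ w ∈ (b.repr P).support, b.repr P w * (rotatedMoment μ (A N) (B N) (b w) -
        ∑ g ∈ Finset.range (K + 1), (((N : ℕ) : ℂ) ^ 2)⁻¹ ^ g *
          coeffFunctional g (A N) (B N) (b w)) := by
    simp only [hφ (rotatedMoment μ (A N) (B N)), hφ (coeffFunctional _ (A N) (B N)), mul_sub,
      Finset.sum_sub_distrib, Finset.mul_sum]
    congr 1
    rw [Finset.sum_comm]
    exact Finset.sum_congr rfl fun w _ => Finset.sum_congr rfl fun g _ => by ring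
  rw [hdiff, Finset.sum_mul, Finset.sum_mul]
  refine (norm_sum_le _ _).trans (Finset.sum_le_sum fun w hw => ?_)
  rw [norm_mul, mul_assoc, mul_assoc, ← mul_assoc (C w)]
  exact mul_le_mul_of_nonneg_left (hC w A B hA hB N μ _ (length_le_ncDegree P hw)) (norm_nonneg _)

end

end FreeExpansion

end

theorem theorem5p9 (k l : ℕ) :
    ∃ free : (N : ℕ+) → (Fin k → Matrix (Fin N) (Fin N) ℂ) → (Fin l → Matrix (Fin N) (Fin N) ℂ) →
        (FreeAlgebra ℂ (Fin k ⊕ Fin l) →ₗ[ℂ] ℂ),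
    ∃ conv : ℕ → (N : ℕ+) → (Fin k → Matrix (Fin N) (Fin N) ℂ) →
        (Fin l → Matrix (Fin N) (Fin N) ℂ) → (FreeAlgebra ℂ (Fin k ⊕ Fin l) →ₗ[ℂ] ℂ),
      -- `free N A B` is the free product of the distributions of `A` and `B`
      (∀ (N : ℕ+) (A : Fin k → Matrix (Fin N) (Fin N) ℂ) (B : Fin l → Matrix (Fin N) (Fin N) ℂ)
        (φ : FreeAlgebra ℂ (Fin k ⊕ Fin l) →ₗ[ℂ] ℂ),
        FreeExpansion.IsFreeProduct (FreeExpansion.ncDist A) (FreeExpansion.ncDist B) φ ↔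
          φ = free N A B) ∧
      -- the two formulas for the coefficients `conv g N A B`, `g ≥ 1`
      (∀ g : ℕ, 1 ≤ g → ∀ (N : ℕ+) (A : Fin k → Matrix (Fin N) (Fin N) ℂ)
        (B : Fin l → Matrix (Fin N) (Fin N) ℂ) (n : ℕ), 1 ≤ n →
        ∀ (P : Fin n → FreeAlgebra ℂ (Fin k)) (Q : Fin n → FreeAlgebra ℂ (Fin l)),
        conv g N A B (FreeExpansion.alternatingProd P Q) =
            ∑ α : Equiv.Perm (Fin n) with FreeExpansion.defect α (finRotate n) ≤ 2 * g,
              FreeExpansion.cumulant (g - FreeExpansion.defect α (finRotate n) / 2) α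
                  (fun s => FreeAlgebra.lift ℂ A (P s)) *
                FreeExpansion.permTrace (α⁻¹ * finRotate n) (fun s => FreeAlgebra.lift ℂ B (Q s)) ∧
        conv g N A B (FreeExpansion.alternatingProd P Q) =
            ∑ a ∈ Finset.range (g + 1), ∑ b ∈ Finset.range (g + 1),
              ∑ α : Equiv.Perm (Fin n), ∑ β : Equiv.Perm (Fin n) with
                2 * a + 2 * b + FreeExpansion.defect α (α * β) +
                  FreeExpansion.defect (α * β) (finRotate n) = 2 * g,
                FreeExpansion.cumulant a α (fun s => FreeAlgebra.lift ℂ A (P s)) *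
                  FreeExpansion.cumulant b β (fun s => FreeAlgebra.lift ℂ B (Q s))) ∧
      -- the expansion to any order `K`, with a constant that depends only on `P` and `K`
      (∀ (P : FreeAlgebra ℂ (Fin k ⊕ Fin l)) (K : ℕ), ∃ C : ℝ,
        ∀ (A : (N : ℕ+) → Fin k → Matrix (Fin N) (Fin N) ℂ)
          (B : (N : ℕ+) → Fin l → Matrix (Fin N) (Fin N) ℂ),
        FreeExpansion.BoundedInDist A → FreeExpansion.BoundedInDist B →
        ∀ (Ω : Type*) [MeasurableSpace Ω] (ℙ : MeasureTheory.Measure Ω)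
          [MeasureTheory.IsProbabilityMeasure ℙ]
          (U : (N : ℕ+) → Ω → Matrix.unitaryGroup (Fin N) ℂ),
        (∀ N, FreeExpansion.IsHaarUnitary ℙ (U N)) →
        ∀ N : ℕ+,
          MeasureTheory.Integrable (fun ω => FreeExpansion.ncDist
            (FreeExpansion.rotatedTuple (A N) (B N) (U N ω)) P) ℙ ∧
          ‖(∫ ω, FreeExpansion.ncDist (FreeExpansion.rotatedTuple (A N) (B N) (U N ω)) P ∂ℙ) -
              (free N (A N) (B N) P +
                ∑ g ∈ Finset.Icc 1 K, ((N : ℂ) ^ (2 * g))⁻¹ * conv g N (A N) (B N) P)‖ ≤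
            C * ((N : ℝ) ^ (2 * K + 2))⁻¹ *
              ∑ a ∈ Finset.Icc 1 (FreeExpansion.ncDegree P),
                ∑ b ∈ Finset.Icc 1 (FreeExpansion.ncDegree P) with
                  a + b ≤ FreeExpansion.ncDegree P,
                  FreeExpansion.starNorm A a * FreeExpansion.starNorm B b) := by
  refine ⟨fun _ A B => FreeExpansion.coeffFunctional 0 A B,
    fun g _ A B => FreeExpansion.coeffFunctional g A B, fun N A B φ => ⟨fun hφ => ?_, ?_⟩,
    fun g _ N A B n hn P Q => ⟨?_, ?_⟩, fun P K => ?_⟩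
  · exact hφ.unique (FreeExpansion.isFreeProduct_coeffFunctional N.ne_zero A B)
      (FreeExpansion.ncDist_one N.ne_zero A)
  · rintro rfl
    exact FreeExpansion.isFreeProduct_coeffFunctional N.ne_zero A B
  · rw [FreeExpansion.coeffFunctional_alternatingProd N.ne_zero A B hn]
    rfl
  · rw [FreeExpansion.coeffFunctional_alternatingProd N.ne_zero A B hn,
      FreeExpansion.mixedCoeff_eq_sum_cumulant_mul_cumulant]
  · obtain ⟨C, hC⟩ := FreeExpansion.exists_polynomial_bound P K
    refine ⟨C, fun A B hA hB Ω _ ℙ _ U hU N => ?_⟩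
    obtain ⟨hm, hH⟩ := hU N
    have hprob : IsProbabilityMeasure (ℙ.map (U N)) := Measure.isProbabilityMeasure_map hm
    have hint : Integrable (fun V => FreeExpansion.ncDist
        (FreeExpansion.rotatedTuple (A N) (B N) V) P) (ℙ.map (U N)) :=
      FreeExpansion.integrable_unitary _ (FreeExpansion.continuous_ncDist_rotatedTuple _ _ P)
    refine ⟨hint.comp_aemeasurable hm, ?_⟩
    have h := hC A B hA hB N (ℙ.map (U N))
    have hmap : FreeExpansion.rotatedMoment (ℙ.map (U N)) (A N) (B N) P =
        ∫ ω, FreeExpansion.ncDist (FreeExpansion.rotatedTuple (A N) (B N) (U N ω)) P ∂ℙ :=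
      integral_map hm hint.aestronglyMeasurable
    have hsum : ∑ g ∈ Finset.range (K + 1), (((N : ℕ) : ℂ) ^ 2)⁻¹ ^ g *
        FreeExpansion.coeffFunctional g (A N) (B N) P =
        FreeExpansion.coeffFunctional 0 (A N) (B N) P + ∑ g ∈ Finset.Icc 1 K,
          ((N : ℂ) ^ (2 * g))⁻¹ * FreeExpansion.coeffFunctional g (A N) (B N) P := by
      rw [Finset.range_eq_Ico, Finset.sum_eq_sum_Ico_succ_bot (Nat.succ_pos K), pow_zero, one_mul]
      simp only [inv_pow, ← pow_mul]
      rfl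
    have hnorm : ‖(((N : ℕ) : ℂ) ^ 2)⁻¹‖ ^ (K + 1) = ((N : ℝ) ^ (2 * K + 2))⁻¹ := by
      rw [norm_inv, norm_pow, Complex.norm_natCast, inv_pow, ← pow_mul, mul_add, mul_one]
    rwa [hmap, hsum, hnorm] at h
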